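/- Let $n\ge 3$ and let $K\subset\mathbb{R}^n$ be a convex body, i.e. a compact convex set with nonempty interior, whose centroid $\frac{1}{V(K)}\int_K x\,dx$ is the origin. Write $V=V(K)$ for its volume. Let $\partial' K$ be the set of boundary points of $K$ at which the outer unit normal $\nu(x)$ is unique, and let $\mu$ be the cone-volume measure of $K$, the Borel measure on $\mathbb{S}^{n-1}$ given by $$\mu(\omega)=\frac1n\int_{\{x\in\partial' K\,:\,\nu(x)\in\omega\}} x\cdot\nu(x)\,d\mathcal{H}^{n-1}(x),$$ where $\mathcal{H}^{n-1}$ is the $(n-1)$-dimensional Hausdorff measure (so that $\mu(\mathbb{S}^{n-1})=V(K)$). Write $\mu(u)$ for $\mu(\{u\})$. Then for every $u\in\mathbb{S}^{n-1}$, $$n\,\frac{\mu(u)+\mu(-u)}{V}+(n+1)^{n-1}\left|\frac{\mu(u)-\mu(-u)}{V}\right|^n\le 1 .$$ Moreover, if equality holds for some $u\in\mathbb{S}^{n-1}$, then there is an $(n-1)$-dimensional convex body $P$ (a compact convex set of dimension $n-1$) lying in a hyperplane $H$ perpendicular to $u$ such that $K$ is - either an oblique prism $K=\operatorname{conv}\bigl(P\cup(P+l)\bigr)$,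 where the translation vector $l\in\mathbb{R}^n$ is not parallel to $H$ (that is, $u\cdot l\neq 0$), - or a cone $K=\operatorname{conv}(P\cup\{p\})$, where $p\in\mathbb{R}^n\setminus H$. Here $\operatorname{conv}$ denotes the convex hull. -/

import Mathlib

open MeasureTheory Metric
open scoped RealInnerProductSpace ENNReal

noncomputable section

namespace LogMinkowski

variable {n : ℕ}

/-- The unit vector `v` is an outer normal of `K` at `x`: the half-space
`{y | ⟪y, v⟫ ≤ ⟪x, v⟫}` contains `K`. -/
def IsOuterUnitNormal (K : ConvexBody (EuclideanSpace ℝ (Fin n))) (x : EuclideanSpace ℝ (Fin n))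
    (v : sphere (0 : EuclideanSpace ℝ (Fin n)) 1) : Prop :=
  ∀ y ∈ K, ⟪y, (v : EuclideanSpace ℝ (Fin n))⟫ ≤ ⟪x, (v : EuclideanSpace ℝ (Fin n))⟫

/-- The set `∂'K` of the boundary points of `K` at which the outer unit normal is unique. -/
def regularBoundary (K : ConvexBody (EuclideanSpace ℝ (Fin n))) :
    Set (EuclideanSpace ℝ (Fin n)) :=
  {x | x ∈ frontier (K : Set (EuclideanSpace ℝ (Fin n))) ∧ ∃! v, IsOuterUnitNormal K x v}

/-- The Gauss map `ν : ∂'K → 𝕊ⁿ⁻¹`. -/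
def gaussMap (K : ConvexBody (EuclideanSpace ℝ (Fin n))) (x : regularBoundary K) :
    sphere (0 : EuclideanSpace ℝ (Fin n)) 1 :=
  x.2.2.choose

/-- The cone-volume measure of a convex body `K` in `ℝⁿ` with the origin in its interior,
`μ(ω) = (1/n) ∫_{ν⁻¹(ω)} ⟪x, ν(x)⟫ dℋⁿ⁻¹(x)`, as a measure on the unit sphere. Here `μHE[n - 1]`
is the `(n-1)`-dimensional Hausdorff measure with the usual normalization, in which it is
Lebesgue measure on hyperplanes; `comap` is its restriction to `∂'K`. -/
def coneVolumeMeasure (K : ConvexBody (EuclideanSpace ℝ (Fin n))) :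
    Measure (sphere (0 : EuclideanSpace ℝ (Fin n)) 1) :=
  ((n : ℝ≥0∞)⁻¹ •
    ((μHE[n - 1] : Measure (EuclideanSpace ℝ (Fin n))).comap
      (Subtype.val : regularBoundary K → EuclideanSpace ℝ (Fin n))).withDensity
        (fun x => ENNReal.ofReal
          ⟪(x : EuclideanSpace ℝ (Fin n)), (gaussMap K x : EuclideanSpace ℝ (Fin n))⟫)).map
    (gaussMap K)

/-- The centroid `(1 / V(K)) ∫_K x dx` of `K`. -/
def centroid (K : ConvexBody (EuclideanSpace ℝ (Fin n))) : EuclideanSpace ℝ (Fin n) :=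
  (volume.real (K : Set (EuclideanSpace ℝ (Fin n))))⁻¹ •
    ∫ x in (K : Set (EuclideanSpace ℝ (Fin n))), x

/-- `P` is an `(n-1)`-dimensional convex body in the hyperplane `{x | ⟪u, x⟫ = c}`, which is
perpendicular to the unit vector `u`. -/
def IsHyperplaneBody (P : ConvexBody (EuclideanSpace ℝ (Fin n)))
    (u : sphere (0 : EuclideanSpace ℝ (Fin n)) 1) (c : ℝ) : Prop :=
  (P : Set (EuclideanSpace ℝ (Fin n))) ⊆ {x | ⟪(u : EuclideanSpace ℝ (Fin n)), x⟫ = c} ∧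
    Module.finrank ℝ (vectorSpan ℝ (P : Set (EuclideanSpace ℝ (Fin n)))) = n - 1

/-- `K = conv (P ∪ (P + l))` for an `(n-1)`-dimensional convex body `P` in a hyperplane
perpendicular to `u` and a translation vector `l` that is not parallel to this hyperplane. -/
def IsObliquePrism (K : ConvexBody (EuclideanSpace ℝ (Fin n)))
    (u : sphere (0 : EuclideanSpace ℝ (Fin n)) 1) : Prop :=
  ∃ (P : ConvexBody (EuclideanSpace ℝ (Fin n))) (c : ℝ) (l : EuclideanSpace ℝ (Fin n)),
    IsHyperplaneBody P u c ∧ ⟪(u : EuclideanSpace ℝ (Fin n)), l⟫ ≠ 0 ∧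
      (K : Set (EuclideanSpace ℝ (Fin n))) =
        convexHull ℝ ((P : Set (EuclideanSpace ℝ (Fin n))) ∪ (fun x => x + l) '' (P : Set _))

/-- `K = conv (P ∪ {p})` for an `(n-1)`-dimensional convex body `P` in a hyperplane
perpendicular to `u` and a point `p` outside this hyperplane. -/
def IsCone (K : ConvexBody (EuclideanSpace ℝ (Fin n)))
    (u : sphere (0 : EuclideanSpace ℝ (Fin n)) 1) : Prop :=
  ∃ (P : ConvexBody (EuclideanSpace ℝ (Fin n))) (c : ℝ) (p : EuclideanSpace ℝ (Fin n)),
    IsHyperplaneBody P u c ∧ ⟪(u : EuclideanSpace ℝ (Fin n)), p⟫ ≠ c ∧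
      (K : Set (EuclideanSpace ℝ (Fin n))) =
        convexHull ℝ ((P : Set (EuclideanSpace ℝ (Fin n))) ∪ {p})

/-! The remaining facts show that the objects above are measurable, so that the cone-volume
measure is given by the expected formula and takes finite values at points. -/

theorem isOuterUnitNormal_gaussMap (K : ConvexBody (EuclideanSpace ℝ (Fin n)))
    (x : regularBoundary K) : IsOuterUnitNormal K x (gaussMap K x) :=
  x.2.2.choose_spec.1

theorem gaussMap_eq (K : ConvexBody (EuclideanSpace ℝ (Fin n))) (x : regularBoundary K)
    {v : sphere (0 : EuclideanSpace ℝ (Fin n)) 1} (hv : IsOuterUnitNormal K x v) :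
    gaussMap K x = v :=
  (x.2.2.choose_spec.2 v hv).symm

theorem isClosed_isOuterUnitNormal (K : ConvexBody (EuclideanSpace ℝ (Fin n))) :
    IsClosed {q : EuclideanSpace ℝ (Fin n) × sphere (0 : EuclideanSpace ℝ (Fin n)) 1 |
      IsOuterUnitNormal K q.1 q.2} := by
  simp only [IsOuterUnitNormal, Set.ofPred_forall]
  exact isClosed_iInter fun y => isClosed_iInter fun _ =>
    isClosed_le (by fun_prop) (by fun_prop)

theorem isCompact_normals (K : ConvexBody (EuclideanSpace ℝ (Fin n))) :
    IsCompact {q : EuclideanSpace ℝ (Fin n) × sphere (0 : EuclideanSpace ℝ (Fin n)) 1 |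
      q.1 ∈ K ∧ IsOuterUnitNormal K q.1 q.2} := by
  refine ((K.isCompact.prod isCompact_univ).inter_right
    (isClosed_isOuterUnitNormal K)).of_isClosed_subset ?_ ?_
  · exact (K.isClosed.preimage continuous_fst).inter (isClosed_isOuterUnitNormal K)
  · rintro q ⟨h1, h2⟩
    exact ⟨⟨h1, trivial⟩, h2⟩

theorem regularBoundary_subset (K : ConvexBody (EuclideanSpace ℝ (Fin n))) :
    regularBoundary K ⊆ K :=
  fun _ hx => K.isClosed.frontier_subset hx.1

theorem continuous_gaussMap (K : ConvexBody (EuclideanSpace ℝ (Fin n))) :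
    Continuous (gaussMap K) := by
  rw [continuous_iff_isClosed]
  intro s hs
  have hc := ((isCompact_normals K).inter_right (hs.preimage continuous_snd)).image continuous_fst
  convert hc.isClosed.preimage (continuous_subtype_val (p := fun x => x ∈ regularBoundary K))
    using 1
  ext x
  constructor
  · intro hx
    exact ⟨(x, gaussMap K x), ⟨⟨regularBoundary_subset K x.2, isOuterUnitNormal_gaussMap K x⟩,
      hx⟩, rfl⟩
  · rintro ⟨⟨a, v⟩, ⟨⟨_, h2⟩, h3⟩, h4⟩
    simp only at h2 h3 h4
    subst h4
    have := gaussMap_eq K x h2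
    simpa [this] using h3

theorem measurableSet_regularBoundary (K : ConvexBody (EuclideanSpace ℝ (Fin n))) :
    MeasurableSet (regularBoundary K) := by
  let C : ℕ → Set (EuclideanSpace ℝ (Fin n) ×
      sphere (0 : EuclideanSpace ℝ (Fin n)) 1 × sphere (0 : EuclideanSpace ℝ (Fin n)) 1) :=
    fun k => {q | q.1 ∈ K ∧ IsOuterUnitNormal K q.1 q.2.1 ∧ IsOuterUnitNormal K q.1 q.2.2 ∧
      1 / ((k : ℝ) + 1) ≤ dist q.2.1 q.2.2}
  have hC : ∀ k, IsCompact (C k) := by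
    intro k
    refine (K.isCompact.prod isCompact_univ).of_isClosed_subset ?_ (fun q hq => ⟨hq.1, trivial⟩)
    exact (K.isClosed.preimage continuous_fst).inter (((isClosed_isOuterUnitNormal K).preimage
      (continuous_fst.prodMk (continuous_fst.comp continuous_snd))).inter
      (((isClosed_isOuterUnitNormal K).preimage
      (continuous_fst.prodMk (continuous_snd.comp continuous_snd))).inter
      (isClosed_le continuous_const ((continuous_fst.comp continuous_snd).dist
        (continuous_snd.comp continuous_snd)))))
  have key : regularBoundary K = (frontier (K : Set (EuclideanSpace ℝ (Fin n))) ∩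
      Prod.fst '' {q : EuclideanSpace ℝ (Fin n) × sphere (0 : EuclideanSpace ℝ (Fin n)) 1 |
        q.1 ∈ K ∧ IsOuterUnitNormal K q.1 q.2}) \ ⋃ k, Prod.fst '' C k := by
    ext x
    constructor
    · rintro ⟨h1, v, hv, huniq⟩
      refine ⟨⟨h1, (x, v), ⟨K.isClosed.frontier_subset h1, hv⟩, rfl⟩, ?_⟩
      simp only [Set.mem_iUnion, not_exists]
      rintro k ⟨⟨a, w, z⟩, ⟨_, hw, hz, hd⟩, rfl⟩
      rw [huniq w hw, huniq z hz, dist_self] at hd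
      have : 0 < 1 / ((k : ℝ) + 1) := by positivity
      linarith
    · rintro ⟨⟨h1, ⟨a, v⟩, ⟨h2, h3⟩, rfl⟩, h4⟩
      refine ⟨h1, v, h3, fun w hw => ?_⟩
      by_contra hne
      obtain ⟨k, hk⟩ := exists_nat_one_div_lt (dist_pos.2 hne)
      exact h4 (Set.mem_iUnion.2 ⟨k, (a, w, v), ⟨h2, hw, h3, hk.le⟩, rfl⟩)
  rw [key]
  exact (isClosed_frontier.measurableSet.inter
    ((isCompact_normals K).image continuous_fst).measurableSet).diff
      (MeasurableSet.iUnion fun k => ((hC k).image continuous_fst).measurableSet)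

theorem coneVolumeMeasure_apply (K : ConvexBody (EuclideanSpace ℝ (Fin n)))
    {ω : Set (sphere (0 : EuclideanSpace ℝ (Fin n)) 1)} (hω : MeasurableSet ω) :
    coneVolumeMeasure K ω = (n : ℝ≥0∞)⁻¹ * ∫⁻ x in gaussMap K ⁻¹' ω, ENNReal.ofReal
        ⟪(x : EuclideanSpace ℝ (Fin n)), (gaussMap K x : EuclideanSpace ℝ (Fin n))⟫
      ∂((μHE[n - 1] : Measure (EuclideanSpace ℝ (Fin n))).comap Subtype.val) := by
  have hm := (continuous_gaussMap K).measurable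
  rw [coneVolumeMeasure, Measure.map_apply hm hω, Measure.smul_apply,
    withDensity_apply _ (hm hω), smul_eq_mul]

/-- The cone-volume measure of a single direction is finite. -/
theorem coneVolumeMeasure_singleton_lt_top (K : ConvexBody (EuclideanSpace ℝ (Fin n)))
    (u : sphere (0 : EuclideanSpace ℝ (Fin n)) 1) : coneVolumeMeasure K {u} < ∞ := by
  have hn : n ≠ 0 := by
    rintro rfl
    have h := u.2
    rw [mem_sphere_zero_iff_norm, Subsingleton.elim (u : EuclideanSpace ℝ (Fin 0)) 0,
      norm_zero] at h
    exact zero_ne_one h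
  obtain ⟨m, rfl⟩ := Nat.exists_eq_succ_of_ne_zero hn
  have hm := (continuous_gaussMap K).measurable
  obtain ⟨R, hR⟩ := K.isCompact.isBounded.exists_norm_le
  rw [coneVolumeMeasure_apply K (measurableSet_singleton u)]
  refine ENNReal.mul_lt_top (by simp) ?_
  refine lt_of_le_of_lt (setLIntegral_mono' (g := fun _ => ENNReal.ofReal R)
    (hm (measurableSet_singleton u)) (fun x _ => ?_)) ?_
  · refine ENNReal.ofReal_le_ofReal ((real_inner_le_norm _ _).trans ?_)
    rw [mem_sphere_zero_iff_norm.1 (gaussMap K x).2, mul_one]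
    exact hR x (regularBoundary_subset K x.2)
  rw [setLIntegral_const]
  refine ENNReal.mul_lt_top ENNReal.ofReal_lt_top ?_
  rw [(MeasurableEmbedding.subtype_coe (measurableSet_regularBoundary K)).comap_apply]
  -- all the points concerned lie on one hyperplane
  rcases (gaussMap K ⁻¹' {u}).eq_empty_or_nonempty with he | ⟨x₀, hx₀⟩
  · simp [he]
  have hin : ∀ x ∈ gaussMap K ⁻¹' {u}, (x : EuclideanSpace ℝ (Fin (m + 1))) - x₀ ∈
      (ℝ ∙ (u : EuclideanSpace ℝ (Fin (m + 1))))ᗮ := by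
    intro x hx
    rw [Submodule.mem_orthogonal_singleton_iff_inner_left, inner_sub_left, sub_eq_zero]
    have h1 := isOuterUnitNormal_gaussMap K x x₀ (regularBoundary_subset K x₀.2)
    have h2 := isOuterUnitNormal_gaussMap K x₀ x (regularBoundary_subset K x.2)
    rw [show gaussMap K x = u from hx] at h1
    rw [show gaussMap K x₀ = u from hx₀] at h2
    exact le_antisymm h2 h1
  have hfr : Module.finrank ℝ (ℝ ∙ (u : EuclideanSpace ℝ (Fin (m + 1))))ᗮ = m := by
    have : Fact (Module.finrank ℝ (EuclideanSpace ℝ (Fin (m + 1))) = m + 1) := ⟨by simp⟩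
    exact Submodule.finrank_orthogonal_span_singleton (by
      intro h
      have := mem_sphere_zero_iff_norm.1 u.2
      rw [h, norm_zero] at this
      exact zero_ne_one this)
  let f : (ℝ ∙ (u : EuclideanSpace ℝ (Fin (m + 1))))ᗮ → EuclideanSpace ℝ (Fin (m + 1)) :=
    fun w => w + x₀
  have hf : Isometry f := (IsometryEquiv.addRight (x₀ : EuclideanSpace ℝ (Fin (m + 1)))).isometry.comp
    isometry_subtype_coe
  have hsub : Subtype.val '' (gaussMap K ⁻¹' {u}) ⊆ f '' closedBall 0 (R + R) := by
    rintro _ ⟨x, hx, rfl⟩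
    refine ⟨⟨_, hin x hx⟩, ?_, by simp [f]⟩
    rw [mem_closedBall_zero_iff]
    exact (norm_sub_le _ _).trans (add_le_add (hR x (regularBoundary_subset K x.2))
      (hR x₀ (regularBoundary_subset K x₀.2)))
  refine (measure_mono hsub).trans_lt ?_
  change μHE[m] (f '' closedBall 0 (R + R)) < ∞
  rw [hf.euclideanHausdorffMeasure_image]
  have hv := InnerProductSpace.euclideanHausdorffMeasure_eq_volume
    (V := (ℝ ∙ (u : EuclideanSpace ℝ (Fin (m + 1))))ᗮ)
  rw [hfr] at hv
  rw [hv]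
  exact measure_closedBall_lt_top

end LogMinkowski

end

/-!
Slice `K` by the hyperplanes orthogonal to `u`. By Brunn's theorem the `m`-th root of the slice
volume, `m = n - 1`, is a concave function of the height, and `n μ(u)` and `n μ(-u)` are at most the
products of the volumes of the two extreme slices with their heights. So the claim is about one
concave profile on an interval, whose barycentre is the origin. Compare the profile with the affine
one (that of a truncated cone, or frustum) having the same mass and first moment: the difference
changes sign at most twice, so the endpoint values of the given profile lie below those of the
frustum. The left side of the inequality increases with the two cone ratios, which reduces the claim
to a one-variable inequality for frusta, with equality only for the cylinder and the cone. In the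
equality case the profile is affine. If one extreme slice has volume zero, `K` is the cone over the
other one; if all slices have the same volume, equality in the Brunn–Minkowski inequality makes the
extreme slices translates of each other, and `K` is an oblique prism.
-/

namespace LogMinkowski

section Slices

/-- The volume of the slice `{y | (t, y) ∈ S}` of a subset `S` of `ℝ × F`. -/
noncomputable def sliceVolume {F : Type*} [MeasureSpace F] (S : Set (ℝ × F)) (t : ℝ) : ℝ :=
  volume.real (Prod.mk t ⁻¹' S)

theorem sliceVolume_nonneg {F : Type*} [MeasureSpace F] (S : Set (ℝ × F)) (t : ℝ) :
    0 ≤ sliceVolume S t :=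
  measureReal_nonneg

theorem isCompact_slice {F : Type*} [TopologicalSpace F] [T2Space F] {S : Set (ℝ × F)}
    (hS : IsCompact S) (t : ℝ) : IsCompact (Prod.mk t ⁻¹' S) :=
  (hS.image continuous_snd).of_isClosed_subset
    (hS.isClosed.preimage (Continuous.prodMk_right t)) fun _ hy => ⟨_, hy, rfl⟩

theorem convex_slice {F : Type*} [AddCommGroup F] [Module ℝ F] {S : Set (ℝ × F)}
    (hS : Convex ℝ S) (t : ℝ) : Convex ℝ (Prod.mk t ⁻¹' S) := fun x hx y hy a b ha hb hab => by
  simpa [← add_mul, hab] using hS hx hy ha hb hab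

theorem bddAbove_range_sliceVolume {F : Type*} [TopologicalSpace F] [MeasureSpace F]
    [IsFiniteMeasureOnCompacts (volume : Measure F)] {S : Set (ℝ × F)} (hS : IsCompact S) :
    BddAbove (Set.range (sliceVolume S)) := by
  refine ⟨volume.real (Prod.snd '' S), ?_⟩
  rintro _ ⟨t, rfl⟩
  exact measureReal_mono (fun y hy => ⟨_, hy, rfl⟩) (hS.image continuous_snd).measure_ne_top

theorem measurable_sliceVolume {F : Type*} [TopologicalSpace F] [T2Space F]
    [SecondCountableTopology F] [MeasureSpace F] [BorelSpace F] [SFinite (volume : Measure F)]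
    {S : Set (ℝ × F)} (hS : IsCompact S) : Measurable (sliceVolume S) :=
  (measurable_measure_prodMk_left hS.measurableSet).ennreal_toReal

variable {F : Type*} [TopologicalSpace F] [T2Space F] [SecondCountableTopology F] [MeasureSpace F]
  [BorelSpace F] [SFinite (volume : Measure F)] [IsFiniteMeasureOnCompacts (volume : Measure F)]
  {S : Set (ℝ × F)}

theorem integrable_sliceVolume (hS : IsCompact S) : Integrable (sliceVolume S) := by
  refine integrable_toReal_of_lintegral_ne_top
    (measurable_measure_prodMk_left hS.measurableSet).aemeasurable ?_
  rw [← Measure.prod_apply hS.measurableSet, ← Measure.volume_eq_prod]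
  exact hS.measure_ne_top

theorem volume_real_eq_integral_sliceVolume (hS : IsCompact S) :
    volume.real S = ∫ t, sliceVolume S t := by
  rw [Measure.real, Measure.volume_eq_prod, Measure.prod_apply hS.measurableSet]
  exact (integral_toReal (measurable_measure_prodMk_left hS.measurableSet).aemeasurable
    (.of_forall fun t => (isCompact_slice hS t).measure_lt_top)).symm

theorem setIntegral_fst_eq_integral_sliceVolume (hS : IsCompact S) :
    ∫ p in S, p.1 = ∫ t, t * sliceVolume S t := by
  have hint : Integrable (S.indicator Prod.fst)
      ((volume : Measure ℝ).prod (volume : Measure F)) := by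
    rw [integrable_indicator_iff hS.measurableSet, ← Measure.volume_eq_prod]
    exact continuous_fst.continuousOn.integrableOn_compact hS
  rw [← integral_indicator hS.measurableSet, Measure.volume_eq_prod, integral_prod _ hint]
  congr 1
  ext t
  have hslice : (fun y => S.indicator Prod.fst (t, y)) =
      (Prod.mk t ⁻¹' S).indicator fun _ : F => t := rfl
  rw [hslice, integral_indicator (isCompact_slice hS t).measurableSet]
  simp [mul_comm, sliceVolume]

end Slices

section BrunnMinkowski

open scoped Pointwise

theorem volume_add_le_of_isCompact {A B : Set ℝ} (hA : IsCompact A) (hB : IsCompact B)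
    (hA' : A.Nonempty) (hB' : B.Nonempty) : volume A + volume B ≤ volume (A + B) := by
  obtain ⟨a, ha, hamax⟩ := hA.exists_isGreatest hA'
  obtain ⟨b, hb, hbmin⟩ := hB.exists_isLeast hB'
  have hdisj : AEDisjoint volume ((· + b) '' A) ((a + ·) '' B) := by
    refine measure_mono_null (t := {a + b}) ?_ (by simp)
    rintro _ ⟨⟨x, hx, rfl⟩, ⟨y, hy, hxy⟩⟩
    have := hamax hx
    have := hbmin hy
    simp only [Set.mem_singleton_iff] at hxy ⊢
    linarith
  calc volume A + volume B = volume ((· + b) '' A) + volume ((a + ·) '' B) := by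
        rw [Set.image_add_right, measure_preimage_add_right, Set.image_add_left,
          measure_preimage_add]
    _ = volume ((· + b) '' A ∪ (a + ·) '' B) :=
        (measure_union₀ (hB.image (by fun_prop)).measurableSet.nullMeasurableSet hdisj).symm
    _ ≤ volume (A + B) := by
        refine measure_mono (Set.union_subset ?_ ?_)
        · rintro _ ⟨x, hx, rfl⟩
          exact Set.add_mem_add hx hb
        · rintro _ ⟨y, hy, rfl⟩
          exact Set.add_mem_add ha hy

theorem volume_add_le {A B : Set ℝ} (hA : MeasurableSet A) (hB : MeasurableSet B)
    (hA' : A.Nonempty) (hB' : B.Nonempty) : volume A + volume B ≤ volume (A + B) := by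
  obtain ⟨a, ha⟩ := hA'
  obtain ⟨b, hb⟩ := hB'
  rw [hA.measure_eq_iSup_isCompact, hB.measure_eq_iSup_isCompact]
  simp only [iSup_and']
  refine ENNReal.biSup_add_biSup_le' (p := fun K => K ⊆ A ∧ IsCompact K)
    (q := fun K => K ⊆ B ∧ IsCompact K) ⟨∅, Set.empty_subset _, isCompact_empty⟩
    ⟨∅, Set.empty_subset _, isCompact_empty⟩ ?_
  rintro K ⟨hKA, hK⟩ L ⟨hLB, hL⟩
  calc volume K + volume L ≤ volume (insert a K) + volume (insert b L) :=
        add_le_add (measure_mono (Set.subset_insert a K)) (measure_mono (Set.subset_insert b L))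
    _ ≤ volume (insert a K + insert b L) :=
        volume_add_le_of_isCompact (hK.insert a) (hL.insert b) (Set.insert_nonempty a K)
          (Set.insert_nonempty b L)
    _ ≤ volume (A + B) :=
        measure_mono (Set.add_subset_add (Set.insert_subset ha hKA) (Set.insert_subset hb hLB))

theorem volume_smul_add_smul_le {A B : Set ℝ} (hA : MeasurableSet A) (hB : MeasurableSet B)
    (hA' : A.Nonempty) (hB' : B.Nonempty) {s t : ℝ} (hs : 0 < s) (ht : 0 < t) :
    ENNReal.ofReal s * volume A + ENNReal.ofReal t * volume B ≤ volume (s • A + t • B) := by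
  have h := volume_add_le (hA.const_smul₀ s) (hB.const_smul₀ t) hA'.smul_set hB'.smul_set
  simpa only [Measure.addHaar_smul, Module.finrank_self, pow_one, abs_of_pos hs, abs_of_pos ht]
    using h

theorem lintegral_ofReal_eq_lintegral_volume_lt {f : ℝ → ℝ} (hf : Measurable f) (hf0 : 0 ≤ f) :
    ∫⁻ x, ENNReal.ofReal (f x) = ∫⁻ r in Set.Ioi (0 : ℝ), volume {x | r < f x} :=
  lintegral_eq_lintegral_meas_lt _ (.of_forall hf0) hf.aemeasurable

theorem measurable_volume_setOf_lt (f : ℝ → ℝ) : Measurable fun r : ℝ => volume {x | r < f x} :=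
  Antitone.measurable fun _ _ hr => measure_mono fun _ hx => lt_of_le_of_lt hr hx

/-- Since `sup f = sup g = 1`, both superlevel sets `{r < f}` and `{r < g}` are nonempty as soon as
one of them is, so that the one-dimensional Brunn–Minkowski inequality applies to them. -/
theorem integral_le_of_forall_min_le {f g h : ℝ → ℝ} (hf : Measurable f) (hg : Measurable g)
    (hh : Measurable h) (hf0 : 0 ≤ f) (hg0 : 0 ≤ g) (hh0 : 0 ≤ h) (hf1 : IsLUB (Set.range f) 1)
    (hg1 : IsLUB (Set.range g) 1) (hfi : Integrable f) (hgi : Integrable g) (hhi : Integrable h)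
    {s t : ℝ} (hs : 0 < s) (ht : 0 < t) (H : ∀ x y, min (f x) (g y) ≤ h (s * x + t * y)) :
    s * (∫ x, f x) + t * (∫ x, g x) ≤ ∫ x, h x := by
  have level : ∀ r : ℝ, ENNReal.ofReal s * volume {x | r < f x}
      + ENNReal.ofReal t * volume {x | r < g x} ≤ volume {x | r < h x} := by
    intro r
    rcases lt_or_ge r 1 with hr1 | hr1
    · obtain ⟨_, ⟨x₀, rfl⟩, hx₀⟩ := (lt_isLUB_iff hf1).1 hr1
      obtain ⟨_, ⟨y₀, rfl⟩, hy₀⟩ := (lt_isLUB_iff hg1).1 hr1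
      refine (volume_smul_add_smul_le (measurableSet_lt measurable_const hf)
        (measurableSet_lt measurable_const hg) ⟨x₀, hx₀⟩ ⟨y₀, hy₀⟩ hs ht).trans (measure_mono ?_)
      rintro _ ⟨_, ⟨x, hx, rfl⟩, _, ⟨y, hy, rfl⟩, rfl⟩
      exact (lt_min hx hy).trans_le (H x y)
    · have empty : ∀ {φ : ℝ → ℝ}, IsLUB (Set.range φ) 1 → {x | r < φ x} = ∅ := fun hφ =>
        Set.eq_empty_of_forall_notMem fun x hx => ((hφ.1 ⟨x, rfl⟩).trans hr1).not_gt hx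
      simp [empty hf1, empty hg1]
  have hmf := measurable_volume_setOf_lt f
  have hmg := measurable_volume_setOf_lt g
  have layers : ENNReal.ofReal s * (∫⁻ x, ENNReal.ofReal (f x))
      + ENNReal.ofReal t * (∫⁻ x, ENNReal.ofReal (g x)) ≤ ∫⁻ x, ENNReal.ofReal (h x) := by
    rw [lintegral_ofReal_eq_lintegral_volume_lt hf hf0,
      lintegral_ofReal_eq_lintegral_volume_lt hg hg0,
      lintegral_ofReal_eq_lintegral_volume_lt hh hh0,
      ← lintegral_const_mul _ hmf, ← lintegral_const_mul _ hmg,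
      ← lintegral_add_left (hmf.const_mul _)]
    exact setLIntegral_mono (measurable_volume_setOf_lt h) fun r _ => level r
  have hF := integral_nonneg (μ := (volume : Measure ℝ)) hf0
  have hG := integral_nonneg (μ := (volume : Measure ℝ)) hg0
  rwa [← ofReal_integral_eq_lintegral_ofReal hfi (.of_forall hf0),
    ← ofReal_integral_eq_lintegral_ofReal hgi (.of_forall hg0),
    ← ofReal_integral_eq_lintegral_ofReal hhi (.of_forall hh0), ← ENNReal.ofReal_mul hs.le,
    ← ENNReal.ofReal_mul ht.le, ← ENNReal.ofReal_add (by positivity) (by positivity),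
    ENNReal.ofReal_le_ofReal_iff (integral_nonneg hh0)] at layers

theorem min_le_rpow_mul_rpow {a b s t : ℝ} (ha : 0 ≤ a) (hb : 0 ≤ b) (hs : 0 ≤ s) (ht : 0 ≤ t)
    (hst : s + t = 1) : min a b ≤ a ^ s * b ^ t := by
  have hmin : 0 ≤ min a b := le_min ha hb
  calc min a b = min a b ^ s * min a b ^ t := by
        rw [← Real.rpow_add_of_nonneg hmin hs ht, hst, Real.rpow_one]
    _ ≤ a ^ s * b ^ t :=
        mul_le_mul (Real.rpow_le_rpow hmin (min_le_left a b) hs)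
          (Real.rpow_le_rpow hmin (min_le_right a b) ht) (by positivity) (by positivity)

theorem isLUB_range_div_ciSup {ι : Sort*} {f : ι → ℝ} (hf : BddAbove (Set.range f))
    (hpos : 0 < ⨆ x, f x) : IsLUB (Set.range fun x => f x / ⨆ x, f x) 1 := by
  have : Nonempty ι := by
    by_contra h
    have := not_nonempty_iff.1 h
    simp at hpos
  refine ⟨?_, fun c hc => ?_⟩
  · rintro _ ⟨x, rfl⟩
    exact (div_le_one hpos).2 (le_ciSup hf x)
  · have hle : ⨆ x, f x ≤ c * ⨆ x, f x := ciSup_le fun x => (div_le_iff₀ hpos).1 (hc ⟨x, rfl⟩)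
    exact (le_mul_iff_one_le_left hpos).1 hle

theorem prekopa_leindler_real {f g h : ℝ → ℝ} (hf : Measurable f) (hg : Measurable g)
    (hh : Measurable h) (hf0 : 0 ≤ f) (hg0 : 0 ≤ g) (hh0 : 0 ≤ h) (hfb : BddAbove (Set.range f))
    (hgb : BddAbove (Set.range g)) (hfi : Integrable f) (hgi : Integrable g) (hhi : Integrable h)
    {s t : ℝ} (hs : 0 < s) (ht : 0 < t) (hst : s + t = 1)
    (H : ∀ x y, f x ^ s * g y ^ t ≤ h (s * x + t * y)) :
    (∫ x, f x) ^ s * (∫ x, g x) ^ t ≤ ∫ x, h x := by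
  rcases (Real.iSup_nonneg hf0).eq_or_lt' with hfz | ha
  · have : f = 0 := funext fun x => le_antisymm ((le_ciSup hfb x).trans hfz.le) (hf0 x)
    simpa [this, Real.zero_rpow hs.ne'] using integral_nonneg hh0
  rcases (Real.iSup_nonneg hg0).eq_or_lt' with hgz | hb
  · have : g = 0 := funext fun x => le_antisymm ((le_ciSup hgb x).trans hgz.le) (hg0 x)
    simpa [this, Real.zero_rpow ht.ne'] using integral_nonneg hh0
  set a := ⨆ x, f x
  set b := ⨆ x, g x
  have hc : 0 < a ^ s * b ^ t := by positivity
  have split : ∀ {v w : ℝ}, 0 ≤ v → 0 ≤ w →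
      (v / a) ^ s * (w / b) ^ t = v ^ s * w ^ t / (a ^ s * b ^ t) := fun hv hw => by
    rw [Real.div_rpow hv ha.le, Real.div_rpow hw hb.le, div_mul_div_comm]
  have hF := integral_nonneg (μ := (volume : Measure ℝ)) hf0
  have hG := integral_nonneg (μ := (volume : Measure ℝ)) hg0
  have additive : s * (∫ x, f x / a) + t * (∫ x, g x / b) ≤ ∫ x, h x / (a ^ s * b ^ t) := by
    have div_nonneg' : ∀ {φ : ℝ → ℝ} {k : ℝ}, 0 ≤ φ → 0 < k → 0 ≤ fun x => φ x / k :=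
      fun hφ hk x => div_nonneg (hφ x) hk.le
    refine integral_le_of_forall_min_le (hf.div_const _) (hg.div_const _) (hh.div_const _)
      (div_nonneg' hf0 ha) (div_nonneg' hg0 hb) (div_nonneg' hh0 hc)
      (isLUB_range_div_ciSup hfb ha) (isLUB_range_div_ciSup hgb hb)
      (hfi.div_const _) (hgi.div_const _) (hhi.div_const _) hs ht fun x y => ?_
    refine (min_le_rpow_mul_rpow (div_nonneg (hf0 x) ha.le) (div_nonneg (hg0 y) hb.le) hs.le ht.le
      hst).trans ?_
    rw [split (hf0 x) (hg0 y)]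
    exact div_le_div_of_nonneg_right (H x y) hc.le
  rw [integral_div, integral_div, integral_div] at additive
  refine (div_le_div_iff_of_pos_right hc).1 ?_
  rw [← split hF hG]
  exact (Real.geom_mean_le_arith_mean2_weighted hs.le ht.le (div_nonneg hF ha.le)
    (div_nonneg hG hb.le) hst).trans additive

theorem smul_slice_add_smul_slice_subset {F : Type*} [AddCommGroup F] [Module ℝ F]
    (A B : Set (ℝ × F)) (s t x y : ℝ) :
    s • (Prod.mk x ⁻¹' A) + t • (Prod.mk y ⁻¹' B) ⊆
      Prod.mk (s * x + t * y) ⁻¹' (s • A + t • B) := by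
  rintro _ ⟨_, ⟨z, hz, rfl⟩, _, ⟨w, hw, rfl⟩, rfl⟩
  exact ⟨_, ⟨_, hz, rfl⟩, _, ⟨_, hw, rfl⟩, rfl⟩

/-- The spaces on which the multiplicative Brunn–Minkowski inequality for compact sets holds;
this property passes from `F` to `ℝ × F` by the Prékopa–Leindler inequality. -/
def HasBrunnMinkowski (F : Type*) [NormedAddCommGroup F] [NormedSpace ℝ F] [MeasureSpace F] :
    Prop :=
  ∀ ⦃A B : Set F⦄, IsCompact A → IsCompact B → ∀ ⦃s t : ℝ⦄, 0 < s → 0 < t → s + t = 1 →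
    volume.real A ^ s * volume.real B ^ t ≤ volume.real (s • A + t • B)

theorem HasBrunnMinkowski.prod {F : Type*} [NormedAddCommGroup F] [NormedSpace ℝ F]
    [SecondCountableTopology F] [MeasureSpace F] [BorelSpace F] [SFinite (volume : Measure F)]
    [IsFiniteMeasureOnCompacts (volume : Measure F)] (hF : HasBrunnMinkowski F) :
    HasBrunnMinkowski (ℝ × F) := by
  intro A B hA hB s t hs ht hst
  have hM : IsCompact (s • A + t • B) := (hA.smul s).add (hB.smul t)
  rw [volume_real_eq_integral_sliceVolume hA, volume_real_eq_integral_sliceVolume hB,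
    volume_real_eq_integral_sliceVolume hM]
  refine prekopa_leindler_real (measurable_sliceVolume hA) (measurable_sliceVolume hB)
    (measurable_sliceVolume hM) (sliceVolume_nonneg A) (sliceVolume_nonneg B) (sliceVolume_nonneg _)
    (bddAbove_range_sliceVolume hA) (bddAbove_range_sliceVolume hB) (integrable_sliceVolume hA)
    (integrable_sliceVolume hB) (integrable_sliceVolume hM) hs ht hst fun x y => ?_
  exact (hF (isCompact_slice hA x) (isCompact_slice hB y) hs ht hst).trans
    (measureReal_mono (smul_slice_add_smul_slice_subset A B s t x y)
      (isCompact_slice hM _).measure_ne_top)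

theorem volume_real_image_of_measurePreserving {E F : Type*} [NormedAddCommGroup E]
    [NormedSpace ℝ E] [MeasureSpace E] [BorelSpace E] [NormedAddCommGroup F] [NormedSpace ℝ F]
    [MeasureSpace F] [BorelSpace F] {e : E ≃L[ℝ] F} (he : MeasurePreserving e) (S : Set E) :
    volume.real (e '' S) = volume.real S := by
  rw [Measure.real, ← he.measure_preimage_emb e.toHomeomorph.measurableEmbedding,
    e.injective.preimage_image, Measure.real]

theorem HasBrunnMinkowski.of_measurePreserving {E F : Type*} [NormedAddCommGroup E]
    [NormedSpace ℝ E] [MeasureSpace E] [BorelSpace E] [NormedAddCommGroup F] [NormedSpace ℝ F]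
    [MeasureSpace F] [BorelSpace F] {e : E ≃L[ℝ] F} (he : MeasurePreserving e)
    (hF : HasBrunnMinkowski F) : HasBrunnMinkowski E := by
  intro A B hA hB s t hs ht hst
  have h := hF (hA.image e.continuous) (hB.image e.continuous) hs ht hst
  rwa [← image_smul_set, ← image_smul_set, ← Set.image_add,
    volume_real_image_of_measurePreserving he, volume_real_image_of_measurePreserving he,
    volume_real_image_of_measurePreserving he] at h

theorem hasBrunnMinkowski_pi_zero : HasBrunnMinkowski (Fin 0 → ℝ) := by
  intro A B _ _ s t hs ht _
  rcases A.eq_empty_or_nonempty with rfl | hA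
  · simp [Real.zero_rpow hs.ne']
  rcases B.eq_empty_or_nonempty with rfl | hB
  · simp [Real.zero_rpow ht.ne']
  have volume_eq_one : ∀ {S : Set (Fin 0 → ℝ)}, S.Nonempty → volume.real S = 1 := fun hS => by
    rw [Subsingleton.eq_univ_of_nonempty hS, Measure.real, ← Set.pi_univ Set.univ, volume_pi_pi]
    simp
  simp [volume_eq_one hA, volume_eq_one hB, volume_eq_one (hA.smul_set.add hB.smul_set)]

theorem measurePreserving_consEquivL_symm (m : ℕ) :
    MeasurePreserving (Fin.consEquivL ℝ fun _ : Fin (m + 1) => ℝ).symm :=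
  volume_preserving_piFinSuccAbove (fun _ : Fin (m + 1) => ℝ) 0

theorem hasBrunnMinkowski_pi (m : ℕ) : HasBrunnMinkowski (Fin m → ℝ) := by
  induction m with
  | zero => exact hasBrunnMinkowski_pi_zero
  | succ m ih => exact .of_measurePreserving (measurePreserving_consEquivL_symm m) ih.prod

theorem volume_real_smul {m : ℕ} {r : ℝ} (hr : 0 ≤ r) (A : Set (Fin m → ℝ)) :
    volume.real (r • A) = r ^ m * volume.real A := by
  rw [Measure.real, Measure.addHaar_smul_of_nonneg _ hr, Module.finrank_pi, Fintype.card_fin,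
    ENNReal.toReal_mul, ENNReal.toReal_ofReal (by positivity), Measure.real]

theorem mul_volume_rpow_inv_le {m : ℕ} (hm : m ≠ 0) {A M : Set (Fin m → ℝ)} (hM : IsCompact M)
    {r : ℝ} (hr : 0 ≤ r) (w : Fin m → ℝ) (h : {w} + r • A ⊆ M) :
    r * volume.real A ^ (m⁻¹ : ℝ) ≤ volume.real M ^ (m⁻¹ : ℝ) := by
  rw [← Real.pow_rpow_inv_natCast hr hm, ← Real.mul_rpow (by positivity) measureReal_nonneg,
    ← volume_real_smul hr]
  refine Real.rpow_le_rpow measureReal_nonneg ?_ (by positivity)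
  calc volume.real (r • A) = volume.real ({w} + r • A) := by
        rw [Set.singleton_add, Set.image_add_left, Measure.real, Measure.real, measure_preimage_add]
    _ ≤ volume.real M := measureReal_mono h hM.measure_ne_top

/-- The multiplicative inequality, applied to the bodies `A` and `B` scaled to volume one. -/
theorem brunn_minkowski_of_pos {m : ℕ} (hm : m ≠ 0) {A B : Set (Fin m → ℝ)} (hA : IsCompact A)
    (hB : IsCompact B) (hA' : 0 < volume.real A) (hB' : 0 < volume.real B) {s t : ℝ}
    (hs : 0 < s) (ht : 0 < t) :
    s * volume.real A ^ (m⁻¹ : ℝ) + t * volume.real B ^ (m⁻¹ : ℝ) ≤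
      volume.real (s • A + t • B) ^ (m⁻¹ : ℝ) := by
  set a := volume.real A ^ (m⁻¹ : ℝ)
  set b := volume.real B ^ (m⁻¹ : ℝ)
  set d := s * a + t * b with hd
  have ha0 : 0 < a := by positivity
  have hb0 : 0 < b := by positivity
  have hd0 : 0 < d := by positivity
  have normalized : ∀ {S : Set (Fin m → ℝ)}, 0 < volume.real S →
      volume.real ((volume.real S ^ (m⁻¹ : ℝ))⁻¹ • S) = 1 := fun {S} hS => by
    rw [volume_real_smul (by positivity), inv_pow, Real.rpow_inv_natCast_pow hS.le hm,
      inv_mul_cancel₀ hS.ne']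
  have hone := hasBrunnMinkowski_pi m (hA.smul a⁻¹) (hB.smul b⁻¹) (s := s * a / d)
    (t := t * b / d) (by positivity) (by positivity) (by rw [← add_div, ← hd, div_self hd0.ne'])
  have hscale : (s * a / d) • a⁻¹ • A + (t * b / d) • b⁻¹ • B = d⁻¹ • (s • A + t • B) := by
    simp only [smul_add, smul_smul]
    congr 2 <;> field_simp
  rw [normalized hA', normalized hB', hscale, volume_real_smul (by positivity), Real.one_rpow,
    Real.one_rpow, one_mul, inv_pow, inv_mul_eq_div, one_le_div (by positivity)] at hone
  calc d = (d ^ m) ^ (m⁻¹ : ℝ) := (Real.pow_rpow_inv_natCast hd0.le hm).symm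
    _ ≤ _ := Real.rpow_le_rpow (by positivity) hone (by positivity)

theorem brunn_minkowski {m : ℕ} (hm : m ≠ 0) {A B : Set (Fin m → ℝ)} (hA : IsCompact A)
    (hB : IsCompact B) (hA' : A.Nonempty) (hB' : B.Nonempty) {s t : ℝ} (hs : 0 < s) (ht : 0 < t) :
    s * volume.real A ^ (m⁻¹ : ℝ) + t * volume.real B ^ (m⁻¹ : ℝ) ≤
      volume.real (s • A + t • B) ^ (m⁻¹ : ℝ) := by
  have hm' : (m⁻¹ : ℝ) ≠ 0 := by positivity
  have hM : IsCompact (s • A + t • B) := (hA.smul s).add (hB.smul t)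
  rcases (measureReal_nonneg (μ := volume) (s := A)).eq_or_lt' with hvA | hvA
  · obtain ⟨x, hx⟩ := hA'
    rw [hvA, Real.zero_rpow hm', mul_zero, zero_add]
    refine mul_volume_rpow_inv_le hm hM ht.le (s • x) (Set.add_subset_add_right ?_)
    exact Set.singleton_subset_iff.2 (Set.smul_mem_smul_set hx)
  rcases (measureReal_nonneg (μ := volume) (s := B)).eq_or_lt' with hvB | hvB
  · obtain ⟨y, hy⟩ := hB'
    rw [hvB, Real.zero_rpow hm', mul_zero, add_zero]
    refine mul_volume_rpow_inv_le hm hM hs.le (t • y) ?_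
    rw [add_comm {t • y}]
    exact Set.add_subset_add_left (Set.singleton_subset_iff.2 (Set.smul_mem_smul_set hy))
  exact brunn_minkowski_of_pos hm hA hB hvA hvB hs ht

end BrunnMinkowski

section ConvexMeasure

variable {E : Type*} [NormedAddCommGroup E] [NormedSpace ℝ E] [MeasurableSpace E] (μ : Measure E)

theorem measure_convex_inter_open_pos [μ.IsOpenPosMeasure] {C U : Set E} (hC : Convex ℝ C)
    (hi : (interior C).Nonempty) (hU : IsOpen U) (h : (C ∩ U).Nonempty) : 0 < μ (C ∩ U) := by
  obtain ⟨x, hx, hxU⟩ := h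
  have hcl : x ∈ closure (interior C) := by
    rw [hC.closure_interior_eq_closure_of_nonempty_interior hi]
    exact subset_closure hx
  obtain ⟨y, hyU, hyi⟩ := mem_closure_iff.1 hcl U hU hxU
  exact ((isOpen_interior.inter hU).measure_pos μ ⟨y, hyi, hyU⟩).trans_le
    (measure_mono (Set.inter_subset_inter_left _ interior_subset))

theorem eq_of_isClosed_of_subset_convex [μ.IsOpenPosMeasure] [OpensMeasurableSpace E] {S C : Set E}
    (hC : Convex ℝ C) (hi : (interior C).Nonempty) (hS : IsClosed S) (hSC : S ⊆ C)
    (hfin : μ C ≠ ∞) (h : μ C ≤ μ S) : S = C := by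
  refine hSC.antisymm fun x hx => ?_
  by_contra hxS
  refine (measure_convex_inter_open_pos μ hC hi hS.isOpen_compl ⟨x, hx, hxS⟩).ne' ?_
  rw [← Set.sdiff_eq, measure_sdiff hSC hS.measurableSet.nullMeasurableSet
    (measure_ne_top_of_subset hSC hfin)]
  exact tsub_eq_zero_of_le h

variable [BorelSpace E] [FiniteDimensional ℝ E] [μ.IsAddHaarMeasure]

theorem nonempty_interior_of_convex_of_measureReal_pos {C : Set E} (hC : Convex ℝ C)
    (h : 0 < μ.real C) : (interior C).Nonempty := by
  by_contra hi
  have hnull : μ C = 0 := by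
    refine measure_mono_null ?_ (hC.addHaar_frontier μ)
    rw [frontier, Set.not_nonempty_iff_eq_empty.1 hi, Set.sdiff_empty]
    exact subset_closure
  simp [Measure.real, hnull] at h

theorem addHaar_levelSet {l : E →L[ℝ] ℝ} (hl : l ≠ 0) (c : ℝ) : μ {x | l x = c} = 0 := by
  rcases {x | l x = c}.eq_empty_or_nonempty with he | ⟨p, rfl⟩
  · rw [he, measure_empty]
  have htranslate : {x | l x = l p} = (· + -p) ⁻¹' (LinearMap.ker l.toLinearMap : Set E) := by
    ext x
    simp [← sub_eq_add_neg, sub_eq_zero]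
  rw [htranslate, measure_preimage_add_right]
  refine Measure.addHaar_submodule _ _ fun h => hl ?_
  ext x
  exact LinearMap.mem_ker.1 (h ▸ Submodule.mem_top : x ∈ LinearMap.ker l.toLinearMap)

end ConvexMeasure

section Quantiles

/-- A continuous distribution function `F` of total mass `A` which is strictly increasing between
its levels `0` and `A`. -/
structure IsStrictCDF (A : ℝ) (F : ℝ → ℝ) : Prop where
  continuous : Continuous F
  monotone : Monotone F
  exists_eq_zero : ∃ x, F x = 0
  exists_eq_top : ∃ x, F x = A
  strictMonoOn : StrictMonoOn F (F ⁻¹' Set.Ioo 0 A)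

/-- The quantile function of a distribution function: it assigns to every value of `F` a point
where this value is attained. -/
noncomputable def quantile (F : ℝ → ℝ) : ℝ → ℝ := Function.invFun F

namespace IsStrictCDF

variable {A : ℝ} {F : ℝ → ℝ}

theorem apply_quantile (hF : IsStrictCDF A F) {a : ℝ} (ha : a ∈ Set.Ioo 0 A) :
    F (quantile F a) = a := by
  obtain ⟨x, hx⟩ := hF.exists_eq_zero
  obtain ⟨y, hy⟩ := hF.exists_eq_top
  refine Function.invFun_eq (mem_range_of_exists_le_of_exists_ge hF.continuous ⟨x, ?_⟩ ⟨y, ?_⟩)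
  · exact hx.trans_le ha.1.le
  · exact ha.2.le.trans_eq hy.symm

theorem quantile_apply (hF : IsStrictCDF A F) {x : ℝ} (hx : F x ∈ Set.Ioo 0 A) :
    quantile F (F x) = x := by
  have h := hF.apply_quantile hx
  exact hF.strictMonoOn.injOn (by rwa [Set.mem_preimage, h]) hx h

theorem monotoneOn_quantile (hF : IsStrictCDF A F) : MonotoneOn (quantile F) (Set.Ioo 0 A) := by
  intro a ha b hb hab
  by_contra! hlt
  have := hF.monotone hlt.le
  rw [hF.apply_quantile ha, hF.apply_quantile hb] at this
  exact hlt.ne' (congrArg (quantile F) (hab.antisymm this))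

theorem continuousAt_quantile (hF : IsStrictCDF A F) {a : ℝ} (ha : a ∈ Set.Ioo 0 A) :
    ContinuousAt (quantile F) a := by
  refine continuousAt_of_monotoneOn_of_image_mem_nhds hF.monotoneOn_quantile
    (isOpen_Ioo.mem_nhds ha) ?_
  have hopen : F ⁻¹' Set.Ioo 0 A ∈ nhds (quantile F a) :=
    (isOpen_Ioo.preimage hF.continuous).mem_nhds (by rwa [Set.mem_preimage, hF.apply_quantile ha])
  exact Filter.mem_of_superset hopen fun x hx => ⟨F x, hx, hF.quantile_apply hx⟩

end IsStrictCDF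

/-- `F`, `G` and `H` behave like the distribution functions of the two convex bodies and their
midpoint body with respect to one linear functional, in the equality case of the Brunn–Minkowski
inequality: both lower and both upper parts satisfy its multiplicative form. -/
structure IsMidpointCDF (A : ℝ) (F G H : ℝ → ℝ) : Prop where
  nonneg : ∀ x, 0 ≤ H x
  le_top : ∀ x, H x ≤ A
  lower : ∀ x y, F x * G y ≤ H ((x + y) / 2) ^ 2
  upper : ∀ x y, (A - F x) * (A - G y) ≤ (A - H ((x + y) / 2)) ^ 2

namespace IsMidpointCDF

variable {A : ℝ} {F G H : ℝ → ℝ}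

theorem symm (h : IsMidpointCDF A F G H) : IsMidpointCDF A G F H where
  nonneg := h.nonneg
  le_top := h.le_top
  lower x y := by rw [mul_comm, add_comm]; exact h.lower y x
  upper x y := by rw [mul_comm, add_comm]; exact h.upper y x

theorem quantile_add_quantile_le_of_lt (h : IsMidpointCDF A F G H) (hF : IsStrictCDF A F)
    (hG : IsStrictCDF A G) {a b c : ℝ} (ha : a ∈ Set.Ioo 0 A) (hb : b ∈ Set.Ioo 0 A) (hc : 0 < c)
    (hcab : c ^ 2 < a * b) : quantile F c + quantile G c ≤ quantile F a + quantile G b := by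
  have hcA : c < A := lt_of_pow_lt_pow_left₀ 2 (ha.1.trans ha.2).le <| hcab.trans <| by
    nlinarith [ha.1, ha.2, hb.1, hb.2]
  by_contra! hlt
  set δ := (quantile F c + quantile G c - (quantile F a + quantile G b)) / 2 with hδ
  have hδ0 : 0 < δ := by linarith
  set z := (quantile F a + quantile G b) / 2 with hz
  have hlow : a * b ≤ H z ^ 2 := by
    simpa only [hF.apply_quantile ha, hG.apply_quantile hb] using
      h.lower (quantile F a) (quantile G b)
  have hup : (A - c) * (A - c) ≤ (A - H z) ^ 2 := by
    have hFc : F (quantile F c - δ) ≤ c :=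
      (hF.monotone (by linarith)).trans_eq (hF.apply_quantile ⟨hc, hcA⟩)
    have hGc : G (quantile G c - δ) ≤ c :=
      (hG.monotone (by linarith)).trans_eq (hG.apply_quantile ⟨hc, hcA⟩)
    have hmid : (quantile F c - δ + (quantile G c - δ)) / 2 = z := by rw [hδ, hz]; ring
    rw [← hmid]
    exact (mul_le_mul (by linarith) (by linarith) (by linarith) (by linarith)).trans
      (h.upper _ _)
  nlinarith [h.nonneg z, h.le_top z]

theorem quantile_add_quantile_le (h : IsMidpointCDF A F G H) (hF : IsStrictCDF A F)
    (hG : IsStrictCDF A G) {a b c : ℝ} (ha : a ∈ Set.Ioo 0 A) (hb : b ∈ Set.Ioo 0 A) (hc : 0 < c)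
    (hcab : c ^ 2 = a * b) : quantile F c + quantile G c ≤ quantile F a + quantile G b := by
  have hcA : c < A := lt_of_pow_lt_pow_left₀ 2 (ha.1.trans ha.2).le <| hcab.trans_lt <| by
    nlinarith [ha.1, ha.2, hb.1, hb.2]
  have hcont : ContinuousAt (fun x => quantile F x + quantile G x) c :=
    (hF.continuousAt_quantile ⟨hc, hcA⟩).add (hG.continuousAt_quantile ⟨hc, hcA⟩)
  refine le_of_tendsto (hcont.mono_left (nhdsWithin_le_nhds (s := Set.Iio c))) ?_
  filter_upwards [Ioo_mem_nhdsLT hc] with x hx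
  refine h.quantile_add_quantile_le_of_lt hF hG ha hb hx.1 ?_
  rw [← hcab]
  exact pow_lt_pow_left₀ hx.2 hx.1.le two_ne_zero

end IsMidpointCDF

/-- Summing the hypothesis along a partition of `[a, b]` of mesh `d` compares `Q b - Q a` with the
increment of `P` over `[a + d, b + d]`. -/
theorem sub_le_sub_of_forall_shifted_increment_le {P Q : ℝ → ℝ} {L a b : ℝ} (hab : a < b)
    (hb : b < L) (hPa : ContinuousAt P a) (hPb : ContinuousAt P b)
    (h : ∀ s d, 0 < d → s + d < L → Q s - Q (s - d) ≤ P (s + d) - P s) :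
    Q b - Q a ≤ P b - P a := by
  let d : ℕ → ℝ := fun N => (b - a) / N
  have hd : Filter.Tendsto d Filter.atTop (nhds 0) := tendsto_const_div_atTop_nhds_zero_nat _
  have shift : ∀ {x}, ContinuousAt P x →
      Filter.Tendsto (fun N => P (x + d N)) Filter.atTop (nhds (P x)) := fun {x} hx =>
    hx.tendsto.comp (by simpa using hd.const_add x)
  refine ge_of_tendsto ((shift hPb).sub (shift hPa)) ?_
  have hsmall : ∀ᶠ N in Filter.atTop, d N < L - b := hd.eventually_lt_const (by linarith)
  filter_upwards [hsmall, Filter.eventually_gt_atTop 0] with N hN hN0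
  have hN0' : (0 : ℝ) < N := Nat.cast_pos.2 hN0
  have hd0 : 0 < d N := div_pos (by linarith) hN0'
  have hNd : a + N * d N = b := by simp only [d]; field_simp; ring
  have step : ∀ i ∈ Finset.range N, Q (a + (i + 1 : ℕ) * d N) - Q (a + i * d N) ≤
      P (a + (i + 1 : ℕ) * d N + d N) - P (a + i * d N + d N) := by
    intro i hi
    have hi' : ((i + 1 : ℕ) : ℝ) * d N ≤ N * d N :=
      mul_le_mul_of_nonneg_right (Nat.cast_le.2 (Finset.mem_range.1 hi)) hd0.le
    have := h (a + (i + 1 : ℕ) * d N) (d N) hd0 (by linarith)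
    convert this using 3 <;> push_cast <;> ring
  have total := Finset.sum_le_sum step
  rw [Finset.sum_range_sub (fun i : ℕ => Q (a + i * d N)),
    Finset.sum_range_sub (fun i : ℕ => P (a + i * d N + d N)), hNd] at total
  simpa using total

namespace IsMidpointCDF

variable {A : ℝ} {F G H : ℝ → ℝ}

/-- On the logarithmic scale `a = exp s` the inequality for the quantiles at `a`, `b` and
`√(a * b)` compares increments over adjacent intervals of the same length. -/
theorem quantile_sub_le_quantile_sub (h : IsMidpointCDF A F G H) (hF : IsStrictCDF A F)
    (hG : IsStrictCDF A G) {a b : ℝ} (ha : 0 < a) (hab : a < b) (hb : b < A) :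
    quantile G b - quantile G a ≤ quantile F b - quantile F a := by
  have hA : 0 < A := ha.trans (hab.trans hb)
  have mem : ∀ {s}, s < Real.log A → Real.exp s ∈ Set.Ioo 0 A := fun hs =>
    ⟨Real.exp_pos _, (Real.lt_log_iff_exp_lt hA).1 hs⟩
  have cont : ∀ {x}, 0 < x → x < A → ContinuousAt (quantile F ∘ Real.exp) (Real.log x) :=
    fun hx hxA => ContinuousAt.comp (by
      rw [Real.exp_log hx]; exact hF.continuousAt_quantile ⟨hx, hxA⟩)
      Real.continuous_exp.continuousAt
  have := sub_le_sub_of_forall_shifted_increment_le (P := quantile F ∘ Real.exp)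
    (Q := quantile G ∘ Real.exp) (Real.log_lt_log ha hab) (Real.log_lt_log (ha.trans hab) hb)
    (cont ha (hab.trans hb)) (cont (ha.trans hab) hb) fun s d hd hs => by
      have := h.quantile_add_quantile_le hF hG (mem hs) (mem (by linarith : s - d < _))
        (Real.exp_pos s) (by rw [← Real.exp_add, ← Real.exp_nat_mul]; congr 1; push_cast; ring)
      simp only [Function.comp_apply]
      linarith
  simpa [Real.exp_log ha, Real.exp_log (ha.trans hab)] using this

theorem exists_quantile_eq_add (h : IsMidpointCDF A F G H) (hF : IsStrictCDF A F)
    (hG : IsStrictCDF A G) : ∃ σ, ∀ a ∈ Set.Ioo 0 A, quantile G a = quantile F a + σ := by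
  have increments : ∀ {a b}, 0 < a → a < b → b < A →
      quantile G b - quantile F b = quantile G a - quantile F a := fun ha hab hb => by
    linarith [h.quantile_sub_le_quantile_sub hF hG ha hab hb,
      h.symm.quantile_sub_le_quantile_sub hG hF ha hab hb]
  refine ⟨quantile G (A / 2) - quantile F (A / 2), fun a ha => ?_⟩
  have hA : 0 < A := ha.1.trans ha.2
  rcases lt_trichotomy a (A / 2) with hlt | rfl | hlt
  · linarith [increments ha.1 hlt (by linarith)]
  · ring
  · linarith [increments (by linarith) hlt ha.2]

end IsMidpointCDF

theorem IsStrictCDF.apply_add_le {A : ℝ} {F G : ℝ → ℝ} (hF : IsStrictCDF A F)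
    (hG : IsStrictCDF A G) (hF0 : ∀ x, 0 ≤ F x) (hGA : ∀ x, G x ≤ A) {σ : ℝ}
    (hσ : ∀ a ∈ Set.Ioo 0 A, quantile G a = quantile F a + σ) (x : ℝ) : G (x + σ) ≤ F x := by
  by_contra! hlt
  obtain ⟨a, hFa, haG⟩ := exists_between hlt
  have ha : a ∈ Set.Ioo 0 A := ⟨(hF0 x).trans_lt hFa, haG.trans_le (hGA _)⟩
  have hx : x < quantile F a := hF.monotone.reflect_lt (by rwa [hF.apply_quantile ha])
  have hy : quantile G a < x + σ := hG.monotone.reflect_lt (by rwa [hG.apply_quantile ha])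
  linarith [hσ a ha]

end Quantiles

section HalfspaceVolume

theorem continuous_measureReal_Iic (ν : Measure ℝ) [IsFiniteMeasure ν] [NullSingletonClass ν] :
    Continuous fun c => ν.real (Set.Iic c) := by
  have hprim : (fun c => ν.real (Set.Iic c)) =
      fun c => ν.real (Set.Iic 0) + ∫ _ in (0 : ℝ)..c, (1 : ℝ) ∂ν := by
    ext c
    rw [← intervalIntegral.integral_Iic_sub_Iic (by simp) (by simp)]
    simp
  rw [hprim]
  exact continuous_const.add
    (intervalIntegral.continuous_primitive (fun _ _ => intervalIntegrable_const) 0)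

variable {E : Type*} [NormedAddCommGroup E] [NormedSpace ℝ E] [MeasurableSpace E]

/-- The distribution function of the linear functional `l` on the set `P`: the measure of the part
of `P` in the half-space `l x ≤ c`. -/
noncomputable def halfspaceVolume (μ : Measure E) (l : E →L[ℝ] ℝ) (P : Set E) (c : ℝ) : ℝ :=
  μ.real (P ∩ {x | l x ≤ c})

variable (μ : Measure E) {l : E →L[ℝ] ℝ} {P P₀ P₁ : Set E}

theorem halfspaceVolume_nonneg (c : ℝ) : 0 ≤ halfspaceVolume μ l P c := measureReal_nonneg

theorem halfspaceVolume_eq_zero {c : ℝ} (h : ∀ x ∈ P, c < l x) : halfspaceVolume μ l P c = 0 := by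
  have : P ∩ {x | l x ≤ c} = ∅ := Set.eq_empty_of_forall_notMem fun x hx => (h x hx.1).not_ge hx.2
  rw [halfspaceVolume, this, measureReal_empty]

theorem halfspaceVolume_eq_measureReal {c : ℝ} (h : ∀ x ∈ P, l x ≤ c) :
    halfspaceVolume μ l P c = μ.real P := by
  rw [halfspaceVolume, Set.inter_eq_left.2 (show P ⊆ {x | l x ≤ c} from h)]

theorem halfspaceVolume_eq_measureReal_map [BorelSpace E] (c : ℝ) :
    halfspaceVolume μ l P c = ((μ.restrict P).map l).real (Set.Iic c) := by
  have hl := l.continuous.measurable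
  rw [map_measureReal_apply hl measurableSet_Iic,
    measureReal_restrict_apply (hl measurableSet_Iic), Set.inter_comm]
  rfl

section IsFiniteMeasureOnCompacts

variable [IsFiniteMeasureOnCompacts μ]

theorem isFiniteMeasure_map_restrict (hP : IsCompact P) :
    IsFiniteMeasure ((μ.restrict P).map l) :=
  have := isFiniteMeasure_restrict.2 (hP.measure_ne_top (μ := μ))
  Measure.isFiniteMeasure_map _ _

theorem halfspaceVolume_le (hP : IsCompact P) (c : ℝ) : halfspaceVolume μ l P c ≤ μ.real P :=
  measureReal_mono Set.inter_subset_left hP.measure_ne_top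

theorem monotone_halfspaceVolume (hP : IsCompact P) : Monotone (halfspaceVolume μ l P) :=
  fun _ _ hcd => measureReal_mono (Set.inter_subset_inter_right _ fun _ hx => le_trans hx hcd)
    (measure_ne_top_of_subset Set.inter_subset_left hP.measure_ne_top)

variable [BorelSpace E]

theorem measureReal_sub_halfspaceVolume_eq_lt (hP : IsCompact P) (c : ℝ) :
    μ.real P - halfspaceVolume μ l P c = μ.real (P ∩ {x | c < l x}) := by
  have hsplit : P \ {x | l x ≤ c} = P ∩ {x | c < l x} := by
    ext x; simp
  rw [halfspaceVolume, ← hsplit, ← measureReal_inter_add_sdiff (s := P)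
    (measurableSet_le l.continuous.measurable (measurable_const (a := c))) hP.measure_ne_top]
  ring

theorem eq_sub_setAverage_of_halfspaceVolume_add_eq [FiniteDimensional ℝ E] (h₀ : IsCompact P₀)
    (h₁ : IsCompact P₁) (hpos : 0 < μ.real P₀) (he : μ.real P₁ = μ.real P₀) {σ : ℝ}
    (h : ∀ c, halfspaceVolume μ l P₁ (c + σ) = halfspaceVolume μ l P₀ c) :
    σ = l ((⨍ x in P₁, x ∂μ) - ⨍ x in P₀, x ∂μ) := by
  have hl := l.continuous.measurable
  have := isFiniteMeasure_map_restrict μ (l := l) h₀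
  have := isFiniteMeasure_map_restrict μ (l := l) h₁
  have hmap : (μ.restrict P₁).map l = (μ.restrict P₀).map fun x => l x + σ := by
    have hcomp : (fun x => l x + σ) = (· + σ) ∘ l := rfl
    rw [hcomp, ← Measure.map_map (by fun_prop) hl]
    refine Measure.ext_of_Iic _ _ fun c => ?_
    rw [Measure.map_apply (f := (· + σ)) (by fun_prop) measurableSet_Iic,
      Set.preimage_add_const_Iic,
      ← measureReal_eq_measureReal_iff (measure_ne_top _ _) (measure_ne_top _ _),
      ← halfspaceVolume_eq_measureReal_map, ← halfspaceVolume_eq_measureReal_map, ← h,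
      sub_add_cancel]
  have hint : ∫ x in P₁, l x ∂μ = ∫ x in P₀, (l x + σ) ∂μ := by
    rw [← integral_map (μ := μ.restrict P₁) hl.aemeasurable (f := fun t : ℝ => t) (by fun_prop),
      hmap, integral_map (by fun_prop) (by fun_prop)]
  have int_id : ∀ {P}, IsCompact P → IntegrableOn (fun x => x) P μ :=
    fun hP => continuous_id.continuousOn.integrableOn_compact hP
  rw [integral_add (l.continuous.continuousOn.integrableOn_compact h₀)
      (integrableOn_const h₀.measure_ne_top),
    l.integral_comp_comm (int_id h₁), l.integral_comp_comm (int_id h₀), integral_const,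
    measureReal_restrict_apply_univ, smul_eq_mul] at hint
  rw [setAverage_eq, setAverage_eq, he, map_sub, map_smul, map_smul, smul_eq_mul, smul_eq_mul, hint]
  field_simp
  ring

theorem halfspaceVolume_lt [μ.IsOpenPosMeasure] (hP : IsCompact P) (hc : Convex ℝ P)
    (hi : (interior P).Nonempty) {x y : E} {c d : ℝ} (hx : x ∈ P) (hy : y ∈ P) (hxc : l x ≤ c)
    (hcd : c < d) (hcy : c < l y) : halfspaceVolume μ l P c < halfspaceVolume μ l P d := by
  obtain ⟨r, hcr, hr⟩ := exists_between (lt_min hcd hcy)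
  obtain ⟨hrd, hry⟩ := lt_min_iff.1 hr
  obtain ⟨z, hz, rfl⟩ := (hc.linear_image l.toLinearMap).ordConnected.out
    ⟨x, hx, rfl⟩ ⟨y, hy, rfl⟩ ⟨hxc.trans hcr.le, hry.le⟩
  have hopen : IsOpen {w | c < l w ∧ l w < d} :=
    (isOpen_lt continuous_const l.continuous).inter (isOpen_lt l.continuous continuous_const)
  have hfin : ∀ S : Set E, μ (P ∩ S) ≠ ∞ := fun S =>
    measure_ne_top_of_subset Set.inter_subset_left hP.measure_ne_top
  have hpos : 0 < μ.real (P ∩ {w | c < l w ∧ l w < d}) := ENNReal.toReal_pos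
    (measure_convex_inter_open_pos μ hc hi hopen ⟨z, hz, hcr, hrd⟩).ne' (hfin _)
  calc halfspaceVolume μ l P c
    _ < μ.real (P ∩ {w | l w ≤ c}) + μ.real (P ∩ {w | c < l w ∧ l w < d}) :=
        lt_add_of_pos_right _ hpos
    _ = μ.real (P ∩ {w | l w ≤ c} ∪ P ∩ {w | c < l w ∧ l w < d}) :=
        (measureReal_union (Set.disjoint_left.2 fun w hw hw' => hw.2.not_gt hw'.2.1)
          (hP.measurableSet.inter hopen.measurableSet) (hfin _) (hfin _)).symm
    _ ≤ halfspaceVolume μ l P d := by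
        refine measureReal_mono ?_ (hfin _)
        rintro w (⟨hw, hw'⟩ | ⟨hw, hw'⟩)
        · exact ⟨hw, le_trans hw' hcd.le⟩
        · exact ⟨hw, hw'.2.le⟩

theorem subset_of_halfspaceVolume_eq [μ.IsOpenPosMeasure] {Q : Set E} (hP : IsCompact P)
    (hc : Convex ℝ P) (hi : (interior P).Nonempty) (hQ : IsClosed Q) (hQc : Convex ℝ Q)
    (hQne : Q.Nonempty)
    (h : ∀ (l : E →L[ℝ] ℝ) (c : ℝ), l ≠ 0 → (∀ x ∈ Q, l x ≤ c) →
      halfspaceVolume μ l P c = μ.real P) : P ⊆ Q := by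
  intro y hy
  by_contra hyQ
  obtain ⟨l, c, hlt, hcy⟩ := geometric_hahn_banach_closed_point hQc hQ hyQ
  have hl : l ≠ 0 := by
    rintro rfl
    obtain ⟨x, hx⟩ := hQne
    exact (hlt x hx).not_gt hcy
  have hpos := measure_convex_inter_open_pos μ hc hi
    (isOpen_lt continuous_const l.continuous) ⟨y, hy, hcy⟩
  have hzero := measureReal_sub_halfspaceVolume_eq_lt μ (l := l) hP c
  rw [h l c hl fun x hx => (hlt x hx).le, sub_self] at hzero
  exact (ENNReal.toReal_pos hpos.ne'
    (measure_ne_top_of_subset Set.inter_subset_left hP.measure_ne_top)).ne hzero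

end IsFiniteMeasureOnCompacts

variable [BorelSpace E] [FiniteDimensional ℝ E] [μ.IsAddHaarMeasure]

theorem measureReal_sub_halfspaceVolume (hP : IsCompact P) (hl : l ≠ 0) (c : ℝ) :
    μ.real P - halfspaceVolume μ l P c = μ.real (P ∩ {x | c ≤ l x}) := by
  rw [measureReal_sub_halfspaceVolume_eq_lt μ hP]
  have hsub : P ∩ {x | c < l x} ⊆ P ∩ {x | c ≤ l x} := fun x hx =>
    ⟨hx.1, (show c < l x from hx.2).le⟩
  refine measureReal_congr (hsub.eventuallyLE.antisymm (ae_le_set.2 ?_))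
  refine measure_mono_null (fun x hx => ?_) (addHaar_levelSet μ hl c)
  exact le_antisymm (not_lt.1 fun h => hx.2 ⟨hx.1.1, h⟩) hx.1.2

theorem continuous_halfspaceVolume (hP : IsCompact P) (hl : l ≠ 0) :
    Continuous (halfspaceVolume μ l P) := by
  have := isFiniteMeasure_map_restrict μ (l := l) hP
  have : NullSingletonClass ((μ.restrict P).map l) := ⟨fun c => by
    rw [Measure.map_apply l.continuous.measurable (measurableSet_singleton c)]
    exact Measure.restrict_le_self.absolutelyContinuous (addHaar_levelSet μ hl c)⟩
  simpa only [← halfspaceVolume_eq_measureReal_map] using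
    continuous_measureReal_Iic ((μ.restrict P).map l)

theorem isStrictCDF_halfspaceVolume (hP : IsCompact P) (hc : Convex ℝ P)
    (hi : (interior P).Nonempty) (hl : l ≠ 0) :
    IsStrictCDF (μ.real P) (halfspaceVolume μ l P) where
  continuous := continuous_halfspaceVolume μ hP hl
  monotone := monotone_halfspaceVolume μ hP
  exists_eq_zero := by
    obtain ⟨a, ha⟩ := (hP.image l.continuous).bddBelow
    exact ⟨a - 1, halfspaceVolume_eq_zero μ fun x hx =>
      (sub_one_lt a).trans_le (ha (Set.mem_image_of_mem l hx))⟩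
  exists_eq_top := by
    obtain ⟨b, hb⟩ := (hP.image l.continuous).bddAbove
    exact ⟨b, halfspaceVolume_eq_measureReal μ fun x hx => hb (Set.mem_image_of_mem l hx)⟩
  strictMonoOn := by
    intro c hcmem d _ hcd
    obtain ⟨x, hx, hxc⟩ : ∃ x ∈ P, l x ≤ c := by
      by_contra! h
      exact hcmem.1.ne' (halfspaceVolume_eq_zero μ h)
    obtain ⟨y, hy, hcy⟩ : ∃ y ∈ P, c < l y := by
      by_contra! h
      exact hcmem.2.ne (halfspaceVolume_eq_measureReal μ h)
    exact halfspaceVolume_lt μ hP hc hi hx hy hxc hcd hcy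

end HalfspaceVolume

section BrunnMinkowskiEquality

open scoped Pointwise

variable {m : ℕ} {P₀ P₁ P : Set (Fin m → ℝ)}

theorem volume_mul_volume_le_of_midpoint_mem {S T U : Set (Fin m → ℝ)} (hS : IsCompact S)
    (hT : IsCompact T) (hU : IsCompact U)
    (h : ∀ x ∈ S, ∀ y ∈ T, (1 / 2 : ℝ) • x + (1 / 2 : ℝ) • y ∈ U) :
    volume.real S * volume.real T ≤ volume.real U ^ 2 := by
  have hsub : (1 / 2 : ℝ) • S + (1 / 2 : ℝ) • T ⊆ U := by
    rintro _ ⟨_, ⟨x, hx, rfl⟩, _, ⟨y, hy, rfl⟩, rfl⟩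
    exact h x hx y hy
  have hbm := (hasBrunnMinkowski_pi m hS hT one_half_pos one_half_pos (add_halves 1)).trans
    (measureReal_mono hsub hU.measure_ne_top)
  rw [← Real.mul_rpow measureReal_nonneg measureReal_nonneg, ← Real.sqrt_eq_rpow] at hbm
  exact (Real.sqrt_le_left measureReal_nonneg).1 hbm

theorem isMidpointCDF_halfspaceVolume (h₀ : IsCompact P₀) (h₁ : IsCompact P₁) (hP : IsCompact P)
    (e₁ : volume.real P₁ = volume.real P₀) (e : volume.real P = volume.real P₀)
    (h : ∀ x ∈ P₀, ∀ y ∈ P₁, (1 / 2 : ℝ) • x + (1 / 2 : ℝ) • y ∈ P)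
    {l : (Fin m → ℝ) →L[ℝ] ℝ} (hl : l ≠ 0) :
    IsMidpointCDF (volume.real P₀) (halfspaceVolume volume l P₀) (halfspaceVolume volume l P₁)
      (halfspaceVolume volume l P) where
  nonneg := halfspaceVolume_nonneg volume
  le_top c := e ▸ halfspaceVolume_le volume hP c
  lower x y := by
    have closed : ∀ c, IsClosed {x | l x ≤ c} := fun c => isClosed_le l.continuous continuous_const
    refine volume_mul_volume_le_of_midpoint_mem (h₀.inter_right (closed x))
      (h₁.inter_right (closed y)) (hP.inter_right (closed _)) ?_
    rintro z ⟨hz, hzx⟩ w ⟨hw, hwy⟩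
    refine ⟨h z hz w hw, ?_⟩
    simp only [Set.mem_ofPred_eq, map_add, map_smul, smul_eq_mul] at hzx hwy ⊢
    linarith
  upper x y := by
    have closed : ∀ c, IsClosed {x | c ≤ l x} := fun c => isClosed_le continuous_const l.continuous
    rw [measureReal_sub_halfspaceVolume volume h₀ hl, ← e₁,
      measureReal_sub_halfspaceVolume volume h₁ hl, e₁, ← e,
      measureReal_sub_halfspaceVolume volume hP hl]
    refine volume_mul_volume_le_of_midpoint_mem (h₀.inter_right (closed x))
      (h₁.inter_right (closed y)) (hP.inter_right (closed _)) ?_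
    rintro z ⟨hz, hzx⟩ w ⟨hw, hwy⟩
    refine ⟨h z hz w hw, ?_⟩
    simp only [Set.mem_ofPred_eq, map_add, map_smul, smul_eq_mul] at hzx hwy ⊢
    linarith

theorem exists_halfspaceVolume_add_eq (h₀ : IsCompact P₀) (h₁ : IsCompact P₁) (hP : IsCompact P)
    (c₀ : Convex ℝ P₀) (c₁ : Convex ℝ P₁) (hpos : 0 < volume.real P₀)
    (e₁ : volume.real P₁ = volume.real P₀) (e : volume.real P = volume.real P₀)
    (h : ∀ x ∈ P₀, ∀ y ∈ P₁, (1 / 2 : ℝ) • x + (1 / 2 : ℝ) • y ∈ P)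
    {l : (Fin m → ℝ) →L[ℝ] ℝ} (hl : l ≠ 0) :
    ∃ σ, ∀ c, halfspaceVolume volume l P₁ (c + σ) = halfspaceVolume volume l P₀ c := by
  have cdf₀ := isStrictCDF_halfspaceVolume volume h₀ c₀
    (nonempty_interior_of_convex_of_measureReal_pos volume c₀ hpos) hl
  have cdf₁ := isStrictCDF_halfspaceVolume volume h₁ c₁
    (nonempty_interior_of_convex_of_measureReal_pos volume c₁ (e₁ ▸ hpos)) hl
  rw [e₁] at cdf₁
  obtain ⟨σ, hσ⟩ := (isMidpointCDF_halfspaceVolume h₀ h₁ hP e₁ e h hl).exists_quantile_eq_add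
    cdf₀ cdf₁
  refine ⟨σ, fun c => le_antisymm ?_ ?_⟩
  · exact cdf₀.apply_add_le cdf₁ (halfspaceVolume_nonneg volume)
      (fun c => e₁ ▸ halfspaceVolume_le volume h₁ c) hσ c
  · simpa using cdf₁.apply_add_le cdf₀ (halfspaceVolume_nonneg volume)
      (halfspaceVolume_le volume h₀) (σ := -σ) (fun a ha => by linarith [hσ a ha]) (c + σ)

/-- For every linear functional the distribution functions of the two bodies differ by a shift, and
the shift is the value of the functional at the difference of the centroids. -/
theorem exists_eq_translate_of_volume_eq (h₀ : IsCompact P₀) (h₁ : IsCompact P₁) (hP : IsCompact P)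
    (c₀ : Convex ℝ P₀) (c₁ : Convex ℝ P₁) (hpos : 0 < volume.real P₀)
    (e₁ : volume.real P₁ = volume.real P₀) (e : volume.real P = volume.real P₀)
    (h : ∀ x ∈ P₀, ∀ y ∈ P₁, (1 / 2 : ℝ) • x + (1 / 2 : ℝ) • y ∈ P) :
    ∃ v, P₁ = (fun x => x + v) '' P₀ := by
  have i₁ := nonempty_interior_of_convex_of_measureReal_pos volume c₁ (e₁ ▸ hpos)
  have i₀ := nonempty_interior_of_convex_of_measureReal_pos volume c₀ hpos
  let v := (⨍ x in P₁, x) - ⨍ x in P₀, x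
  have hclosed : IsCompact ((fun x => x + v) '' P₀) := h₀.image (by fun_prop)
  have hconv : Convex ℝ ((fun x => x + v) '' P₀) := by
    simpa only [add_comm v] using c₀.translate v
  have hne : ((fun x => x + v) '' P₀).Nonempty := (i₀.mono interior_subset).image _
  have hvol : volume ((fun x => x + v) '' P₀) = volume P₁ := by
    rw [Set.image_add_right, measure_preimage_add_right]
    exact (measureReal_eq_measureReal_iff h₀.measure_ne_top h₁.measure_ne_top).1 e₁.symm
  have hsub : P₁ ⊆ (fun x => x + v) '' P₀ := by
    refine subset_of_halfspaceVolume_eq volume h₁ c₁ i₁ hclosed.isClosed hconv hne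
      fun l c hl hle => ?_
    obtain ⟨σ, hσ⟩ := exists_halfspaceVolume_add_eq h₀ h₁ hP c₀ c₁ hpos e₁ e h hl
    have hσv := eq_sub_setAverage_of_halfspaceVolume_add_eq volume h₀ h₁ hpos e₁ hσ
    rw [← sub_add_cancel c σ, hσ, e₁]
    refine halfspaceVolume_eq_measureReal volume fun x hx => ?_
    have := hle _ (Set.mem_image_of_mem _ hx)
    rw [map_add] at this
    linarith
  refine ⟨v, eq_of_isClosed_of_subset_convex volume hconv ?_ h₁.isClosed hsub
    hclosed.measure_ne_top hvol.le⟩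
  exact i₁.mono (interior_mono hsub)

end BrunnMinkowskiEquality

section PowerInequalities

variable {x r : ℝ} {k m : ℕ}

theorem succ_mul_pow_mul_one_sub_sq_lt (h0 : 0 < x) (h1 : x < 1) (hm : m ≠ 0) :
    (m + 1) * x ^ m * (1 - x ^ 2) < 1 - x ^ (2 * m + 2) := by
  have hsq : 0 < 1 - x ^ 2 := by nlinarith
  have hxx : 2 * x < 1 + x ^ 2 := by nlinarith [pow_pos (sub_pos.2 h1) 2]
  induction m, Nat.one_le_iff_ne_zero.2 hm using Nat.le_induction with
  | base => norm_num; nlinarith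
  | succ m hm ih =>
    have ih := ih (by omega)
    have hleft : (m + 1) * x ^ m * (1 - x ^ 2) * (2 * x) < (1 - x ^ (2 * m + 2)) * (1 + x ^ 2) :=
      mul_lt_mul'' ih hxx (by positivity) (by positivity)
    have hright : 2 * x ^ (m + 1) * (1 - x ^ 2) ≤ (1 + (x ^ (m + 1)) ^ 2) * (1 - x ^ 2) :=
      mul_le_mul_of_nonneg_right (by nlinarith [sq_nonneg (1 - x ^ (m + 1))]) hsq.le
    push_cast
    linear_combination (hleft + hright) / 2

theorem add_two_mul_pow_mul_one_sub_pow_four_le (h0 : 0 < x) (h1 : x < 1) (k : ℕ) :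
    (k + 2) * x ^ k * (1 - x ^ 4) ≤ 2 * (1 - x ^ (2 * k + 4)) := by
  have hpow : ∀ j, x ^ j ≤ 1 := fun j => pow_le_one₀ h0.le h1.le
  have hsq : 0 ≤ 1 - x ^ 2 := sub_nonneg.2 (hpow 2)
  induction k with
  | zero => simp
  | succ k ih =>
    have hleft : (k + 2) * x ^ k * (1 - x ^ 4) * (2 * x) ≤
        2 * (1 - x ^ (2 * k + 4)) * (1 + x ^ 2) :=
      mul_le_mul ih (by nlinarith [sq_nonneg (1 - x)]) (by positivity)
        (mul_nonneg zero_le_two (sub_nonneg.2 (hpow _)))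
    have hright : 0 ≤ (1 - x ^ (k + 1)) * (1 - x ^ (k + 3)) * (1 - x ^ 2) :=
      mul_nonneg (mul_nonneg (sub_nonneg.2 (hpow _)) (sub_nonneg.2 (hpow _))) hsq
    push_cast
    linear_combination hleft / 2 + hright

theorem one_sub_pow_mul_one_add_lt (h0 : 0 < r) (h1 : r < 1) (hm : m ≠ 0) :
    (1 - r ^ (m + 1)) * (1 + r) < (m + 1) * (1 + r ^ (m + 1)) * (1 - r) := by
  have hr : 0 < 1 - r := sub_pos.2 h1
  induction m, Nat.one_le_iff_ne_zero.2 hm using Nat.le_induction with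
  | base => norm_num; nlinarith [pow_pos hr 3]
  | succ m hm ih =>
    have ih := mul_lt_mul_of_pos_right (ih (by omega)) (by linarith : 0 < 1 + r)
    have hpow : 0 < 1 - r ^ (m + 1) := sub_pos.2 (pow_lt_one₀ h0.le h1 (by omega))
    have hrest : 0 < (m + 2) * ((1 - r ^ (m + 1)) * (1 - r) ^ 2) := by positivity
    push_cast
    linear_combination (ih + hrest) / 2

theorem mul_pow_mul_one_add_mul_one_sub_sq_lt (h0 : 0 < r) (h1 : r < 1) (hk : k ≠ 0) :
    (k + 2) * (k + 1) * r ^ k * (1 + r) * (1 - r) ^ 2 <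
      2 * (1 - r ^ (k + 2)) * (1 - r ^ (k + 1)) := by
  obtain ⟨x, hx0, rfl⟩ : ∃ x, 0 < x ∧ r = x ^ 2 :=
    ⟨√r, Real.sqrt_pos.2 h0, (Real.sq_sqrt h0.le).symm⟩
  have hx1 : x < 1 := by nlinarith
  have hfour : 0 < 1 - x ^ 4 := sub_pos.2 (pow_lt_one₀ hx0.le hx1 (by norm_num))
  have hle := add_two_mul_pow_mul_one_sub_pow_four_le hx0 hx1 k
  have hprod := mul_lt_mul' hle (succ_mul_pow_mul_one_sub_sq_lt hx0 hx1 hk)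
    (by have := sub_pos.2 h1; positivity) (lt_of_lt_of_le (by positivity) hle)
  linear_combination hprod

/-- For the truncated cone of dimension `m + 1` whose parallel faces have ratio `r` and whose
centroid is the origin, let `x` and `y` be the fractions of the volume taken by the cones over the
smaller and the larger face. Then `(m + 2) * (1 - (m + 1) * (x + y))` is the quotient of
`frustumDefect m r` by `(1 - r ^ (m + 1)) ^ 2`. -/
noncomputable def frustumDefect (m : ℕ) (r : ℝ) : ℝ :=
  (1 - r ^ (m + 1)) ^ 2 - (m + 1) ^ 2 * r ^ m * (1 - r) ^ 2

/-- In the notation of `frustumDefect`, the number `(m + 2) * (y - x)` is the quotient of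
`frustumGap m r` by `(1 - r ^ (m + 1)) ^ 2`. -/
noncomputable def frustumGap (m : ℕ) (r : ℝ) : ℝ :=
  1 - r ^ (2 * m + 2) - (m + 1) * r ^ m * (1 - r ^ 2)

theorem frustumDefect_pos (h0 : 0 ≤ r) (h1 : r < 1) (hm : m ≠ 0) : 0 < frustumDefect m r := by
  rcases h0.eq_or_lt with rfl | h0
  · simp [frustumDefect, hm]
  obtain ⟨x, hx0, rfl⟩ : ∃ x, 0 < x ∧ r = x ^ 2 :=
    ⟨√r, Real.sqrt_pos.2 h0, (Real.sq_sqrt h0.le).symm⟩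
  have hx1 : x < 1 := by nlinarith
  have hlt := pow_lt_pow_left₀ (succ_mul_pow_mul_one_sub_sq_lt hx0 hx1 hm)
    (by have := sub_pos.2 h1; positivity) two_ne_zero
  rw [frustumDefect]
  linear_combination hlt

theorem frustumGap_pos (h0 : 0 ≤ r) (h1 : r < 1) (hm : m ≠ 0) : 0 < frustumGap m r := by
  rcases h0.eq_or_lt with rfl | h0
  · simp [frustumGap, hm]
  · exact sub_pos.2 (succ_mul_pow_mul_one_sub_sq_lt h0 h1 hm)

theorem one_sub_pow_succ_pos (h0 : 0 ≤ r) (h1 : r < 1) (m : ℕ) : 0 < 1 - r ^ (m + 1) :=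
  sub_pos.2 (pow_lt_one₀ h0 h1 m.succ_ne_zero)

theorem hasDerivAt_frustumDefect (k : ℕ) (r : ℝ) : HasDerivAt (frustumDefect (k + 1))
    (2 * (1 - r ^ (k + 2)) * (-((k + 2) * r ^ (k + 1))) -
      (k + 2) ^ 2 * ((k + 1) * r ^ k * (1 - r) ^ 2 - r ^ (k + 1) * (2 * (1 - r)))) r := by
  have h := (((hasDerivAt_pow (k + 2) r).const_sub 1).pow 2).sub
    (((hasDerivAt_pow (k + 1) r).const_mul (((k + 1 : ℕ) + 1 : ℝ) ^ 2)).mul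
      (((hasDerivAt_id r).const_sub 1).pow 2))
  refine h.congr_deriv ?_
  push_cast
  simp only [pow_one, mul_neg, id_eq, Pi.pow_apply, mul_one, sub_right_inj]
  ring

theorem hasDerivAt_frustumGap (k : ℕ) (r : ℝ) : HasDerivAt (frustumGap (k + 1))
    (-((2 * k + 4) * r ^ (2 * k + 3)) -
      (k + 2) * ((k + 1) * r ^ k * (1 - r ^ 2) - r ^ (k + 1) * (2 * r))) r := by
  have h := ((hasDerivAt_pow (2 * (k + 1) + 2) r).const_sub 1).sub
    (((hasDerivAt_pow (k + 1) r).const_mul ((k + 1 : ℕ) + 1 : ℝ)).mul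
      ((hasDerivAt_pow 2 r).const_sub 1))
  refine h.congr_deriv ?_
  push_cast
  simp only [pow_one, mul_neg]
  ring

theorem hasDerivAt_one_sub_pow_sq (k : ℕ) (r : ℝ) : HasDerivAt (fun r : ℝ => (1 - r ^ (k + 2)) ^ 2)
    (2 * (1 - r ^ (k + 2)) * (-((k + 2) * r ^ (k + 1)))) r := by
  refine (((hasDerivAt_pow (k + 2) r).const_sub 1).pow 2).congr_deriv ?_
  push_cast
  simp

/-- The logarithm of the quotient of the two sides of `frustumGap_pow_lt`. -/
noncomputable def frustumLogRatio (m : ℕ) (r : ℝ) : ℝ :=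
  (m + 1) * Real.log (frustumGap m r) - Real.log (frustumDefect m r) -
    m * Real.log ((1 - r ^ (m + 1)) ^ 2)

theorem hasDerivAt_frustumLogRatio (h0 : 0 ≤ r) (h1 : r < 1) (k : ℕ) :
    HasDerivAt (frustumLogRatio (k + 1)) (-((k + 2) ^ 2 * r ^ (k + 1) * (1 - r ^ (k + 2)) *
      ((k + 2) * (1 + r ^ (k + 2)) * (1 - r) - (1 - r ^ (k + 2)) * (1 + r)) *
      (2 * (1 - r ^ (k + 2)) * (1 - r ^ (k + 1)) -
        (k + 2) * (k + 1) * r ^ k * (1 + r) * (1 - r) ^ 2)) /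
      (frustumDefect (k + 1) r * frustumGap (k + 1) r * (1 - r ^ (k + 2)) ^ 2)) r := by
  have hdefect := (frustumDefect_pos h0 h1 k.succ_ne_zero).ne'
  have hgap := (frustumGap_pos h0 h1 k.succ_ne_zero).ne'
  have hpow := (one_sub_pow_succ_pos h0 h1 (k + 1)).ne'
  refine (((((hasDerivAt_frustumGap k r).log hgap).const_mul ((k + 1 : ℕ) + 1 : ℝ)).sub
    ((hasDerivAt_frustumDefect k r).log hdefect)).sub
    (((hasDerivAt_one_sub_pow_sq k r).log (pow_ne_zero 2 hpow)).const_mul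
      ((k + 1 : ℕ) : ℝ))).congr_deriv ?_
  rw [eq_div_iff (mul_ne_zero (mul_ne_zero hdefect hgap) (pow_ne_zero 2 hpow))]
  push_cast
  field_simp
  simp only [frustumDefect, frustumGap]
  push_cast
  ring

theorem strictAntiOn_frustumLogRatio (hm : 2 ≤ m) :
    StrictAntiOn (frustumLogRatio m) (Set.Ico 0 1) := by
  obtain ⟨k, rfl⟩ := Nat.exists_eq_add_of_le' hm
  refine strictAntiOn_of_deriv_neg (convex_Ico 0 1) (fun r hr =>
    (hasDerivAt_frustumLogRatio hr.1 hr.2 (k + 1)).continuousAt.continuousWithinAt) fun r hr => ?_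
  rw [interior_Ico] at hr
  rw [(hasDerivAt_frustumLogRatio hr.1.le hr.2 (k + 1)).deriv]
  have hdefect := frustumDefect_pos hr.1.le hr.2 (k + 1).succ_ne_zero
  have hgap := frustumGap_pos hr.1.le hr.2 (k + 1).succ_ne_zero
  have hpow := one_sub_pow_succ_pos hr.1.le hr.2 (k + 2)
  have hfst := sub_pos.2
    (one_sub_pow_mul_one_add_lt (m := k + 2) hr.1 hr.2 (k + 1).succ_ne_zero)
  have hsnd := sub_pos.2 (mul_pow_mul_one_add_mul_one_sub_sq_lt hr.1 hr.2 k.succ_ne_zero)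
  have hr0 := hr.1
  refine div_neg_of_neg_of_pos (neg_neg_of_pos ?_) (by positivity)
  refine mul_pos (mul_pos (by positivity) (hfst.trans_eq ?_)) hsnd
  push_cast
  ring

theorem frustumGap_pow_lt (h0 : 0 < r) (h1 : r < 1) (hm : 2 ≤ m) :
    frustumGap m r ^ (m + 1) < frustumDefect m r * ((1 - r ^ (m + 1)) ^ 2) ^ m := by
  have hm0 : m ≠ 0 := by omega
  have hdefect := frustumDefect_pos h0.le h1 hm0
  have hgap := frustumGap_pos h0.le h1 hm0
  have hpow := one_sub_pow_succ_pos h0.le h1 m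
  have hlt : frustumLogRatio m r < frustumLogRatio m 0 :=
    strictAntiOn_frustumLogRatio hm (Set.left_mem_Ico.2 one_pos) ⟨h0.le, h1⟩ h0
  have hzero : frustumLogRatio m 0 = 0 := by
    simp [frustumLogRatio, frustumGap, frustumDefect, hm0]
  rw [← Real.log_lt_log_iff (by positivity) (by positivity),
    Real.log_mul hdefect.ne' (by positivity), Real.log_pow, Real.log_pow]
  rw [hzero, frustumLogRatio] at hlt
  push_cast
  linarith

end PowerInequalities

section OppositeConeSum

/-- The left-hand side of the inequality between the volumes `x` and `y` of the cones over two
opposite facets of an `n`-dimensional body of volume `1`. -/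
noncomputable def oppositeConeSum (n : ℕ) (x y : ℝ) : ℝ :=
  n * (x + y) + ((n : ℝ) + 1) ^ (n - 1) * |x - y| ^ n

variable {n : ℕ} {x y X Y : ℝ}

theorem oppositeConeSum_comm (n : ℕ) (x y : ℝ) : oppositeConeSum n x y = oppositeConeSum n y x := by
  rw [oppositeConeSum, oppositeConeSum, add_comm x, abs_sub_comm]

theorem succ_mul_oppositeConeSum (hn : n ≠ 0) (x y : ℝ) : ((n : ℝ) + 1) * oppositeConeSum n x y =
    n * ((n + 1) * (x + y)) + ((n + 1) * |x - y|) ^ n := by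
  obtain ⟨k, rfl⟩ := Nat.exists_eq_succ_of_ne_zero hn
  rw [oppositeConeSum, Nat.succ_sub_one, mul_pow, Nat.succ_eq_add_one]
  ring

/-- Bernoulli's inequality bounds the power in `oppositeConeSum` by its tangent line. -/
theorem succ_mul_le_one_of_oppositeConeSum_le_one (hn : n ≠ 0) (h : oppositeConeSum n x y ≤ 1) :
    ((n : ℝ) + 1) * x ≤ 1 := by
  have hbernoulli := one_add_mul_le_pow (a := ((n : ℝ) + 1) * |x - y| - 1)
    (by nlinarith [abs_nonneg (x - y)]) n
  rw [add_sub_cancel] at hbernoulli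
  have hsum := mul_le_mul_of_nonneg_left h (by positivity : (0 : ℝ) ≤ n + 1)
  rw [succ_mul_oppositeConeSum hn] at hsum
  have hdouble : (n : ℝ) * ((n + 1) * (x + y + |x - y|)) ≤ n * 2 := by linarith
  have hmax := le_of_mul_le_mul_left hdouble (by positivity)
  nlinarith [mul_le_mul_of_nonneg_left (le_abs_self (x - y)) (by positivity : (0 : ℝ) ≤ n + 1)]

theorem pow_sub_pow_lt_mul_sub {e f : ℝ} (he : 0 ≤ e) (hef : e < f) (hf : f ≤ 1) (hn : 2 ≤ n) :
    f ^ n - e ^ n < n * (f - e) := by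
  induction n, hn using Nat.le_induction with
  | base =>
    have : 0 < (f - e) * (2 - f - e) := mul_pos (by linarith) (by linarith)
    push_cast
    linear_combination this
  | succ n _ ih =>
    have he1 : e ^ n ≤ 1 := pow_le_one₀ he (by linarith)
    have hef' : e ^ n ≤ f ^ n := pow_le_pow_left₀ he hef.le _
    have : f ^ (n + 1) - e ^ (n + 1) = f * (f ^ n - e ^ n) + e ^ n * (f - e) := by ring
    push_cast
    nlinarith

theorem oppositeConeSum_lt_of_abs_sub_lt (hn : 2 ≤ n) (hxX : x ≤ X) (hyY : y ≤ Y)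
    (hlt : |X - Y| < |x - y|) (h1 : ((n : ℝ) + 1) * |x - y| ≤ 1) :
    oppositeConeSum n x y < oppositeConeSum n X Y := by
  have hpow := pow_sub_pow_lt_mul_sub (by positivity : 0 ≤ ((n : ℝ) + 1) * |X - Y|)
    (mul_lt_mul_of_pos_left hlt (by positivity)) h1 hn
  have htri : |x - y| - |X - Y| ≤ (X - x) + (Y - y) := by
    refine (abs_sub_abs_le_abs_sub _ _).trans (abs_le.2 ⟨?_, ?_⟩) <;> linarith
  have hscaled := mul_le_mul_of_nonneg_left htri (by positivity : (0 : ℝ) ≤ n * (n + 1))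
  have hn0 : n ≠ 0 := by omega
  refine lt_of_mul_lt_mul_left ?_ (by positivity : (0 : ℝ) ≤ n + 1)
  rw [succ_mul_oppositeConeSum hn0, succ_mul_oppositeConeSum hn0]
  linarith

theorem oppositeConeSum_mono (hn : 2 ≤ n) (hx : 0 ≤ x) (hy : 0 ≤ y) (hxX : x ≤ X) (hyY : y ≤ Y)
    (h : oppositeConeSum n X Y ≤ 1) : oppositeConeSum n x y ≤ oppositeConeSum n X Y ∧
      (oppositeConeSum n x y = oppositeConeSum n X Y → x = X ∧ y = Y) := by
  have hn0 : n ≠ 0 := by omega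
  rcases le_or_gt |x - y| |X - Y| with hle | hlt
  · have hpow : ((n : ℝ) + 1) ^ (n - 1) * |x - y| ^ n ≤ ((n : ℝ) + 1) ^ (n - 1) * |X - Y| ^ n := by
      gcongr
    have hlin : (n : ℝ) * (x + y) ≤ n * (X + Y) := by gcongr
    refine ⟨add_le_add hlin hpow, fun heq => ?_⟩
    have hge : (n : ℝ) * (X + Y) ≤ n * (x + y) := by
      rw [oppositeConeSum, oppositeConeSum] at heq
      linarith
    have := le_of_mul_le_mul_left hge (by positivity)
    constructor <;> linarith
  · have hX := succ_mul_le_one_of_oppositeConeSum_le_one hn0 h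
    have hY := succ_mul_le_one_of_oppositeConeSum_le_one hn0 (oppositeConeSum_comm n X Y ▸ h)
    have h1 : ((n : ℝ) + 1) * |x - y| ≤ 1 := by
      rcases abs_cases (x - y) with ⟨e, _⟩ | ⟨e, _⟩ <;> rw [e] <;> nlinarith
    have hsum := oppositeConeSum_lt_of_abs_sub_lt hn hxX hyY hlt h1
    exact ⟨hsum.le, fun heq => absurd heq hsum.ne⟩

end OppositeConeSum

section Profile

variable {m : ℕ} {f g : ℝ → ℝ} {κ : ℝ}

/-- The volume of a body of dimension `m + 1` of unit width whose slice at height `s` has the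
volume of a cube with edge length `g s`. -/
noncomputable def profileMass (m : ℕ) (g : ℝ → ℝ) : ℝ := ∫ s in (0 : ℝ)..1, g s ^ m

/-- The first moment, in the direction of height, of a body as in `profileMass`. -/
noncomputable def profileMoment (m : ℕ) (g : ℝ → ℝ) : ℝ := ∫ s in (0 : ℝ)..1, s * g s ^ m

/-- The fraction of the volume of a body as in `profileMass` that is taken by the cone over its
face at height `1` with apex at the centroid. -/
noncomputable def topConeRatio (m : ℕ) (g : ℝ → ℝ) : ℝ :=
  (profileMass m g - profileMoment m g) * g 1 ^ m / ((m + 1) * profileMass m g ^ 2)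

/-- The fraction of the volume of a body as in `profileMass` that is taken by the cone over its
face at height `0` with apex at the centroid. -/
noncomputable def bottomConeRatio (m : ℕ) (g : ℝ → ℝ) : ℝ :=
  profileMoment m g * g 0 ^ m / ((m + 1) * profileMass m g ^ 2)

/-- The edge lengths, as functions of height, of the bodies considered in `profileMass`. -/
structure IsProfile (m : ℕ) (g : ℝ → ℝ) : Prop where
  nonneg : ∀ s ∈ Set.Icc (0 : ℝ) 1, 0 ≤ g s
  intervalIntegrable : IntervalIntegrable (fun s => g s ^ m) volume 0 1

theorem IsProfile.intervalIntegrable_id_mul (hg : IsProfile m g) :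
    IntervalIntegrable (fun s => s * g s ^ m) volume 0 1 :=
  hg.intervalIntegrable.continuousOn_mul continuousOn_id

theorem IsProfile.smul (hg : IsProfile m g) (hκ : 0 ≤ κ) : IsProfile m (κ • g) where
  nonneg s hs := mul_nonneg hκ (hg.nonneg s hs)
  intervalIntegrable := by
    simpa only [Pi.smul_apply, smul_eq_mul, mul_pow] using hg.intervalIntegrable.const_mul _

theorem profileMass_smul (m : ℕ) (κ : ℝ) (g : ℝ → ℝ) :
    profileMass m (κ • g) = κ ^ m * profileMass m g := by
  simp only [profileMass, Pi.smul_apply, smul_eq_mul, mul_pow, intervalIntegral.integral_const_mul]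

theorem profileMoment_smul (m : ℕ) (κ : ℝ) (g : ℝ → ℝ) :
    profileMoment m (κ • g) = κ ^ m * profileMoment m g := by
  simp only [profileMoment, Pi.smul_apply, smul_eq_mul, mul_pow, mul_left_comm _ (κ ^ m),
    intervalIntegral.integral_const_mul]

theorem topConeRatio_smul (hκ : κ ≠ 0) (m : ℕ) (g : ℝ → ℝ) :
    topConeRatio m (κ • g) = topConeRatio m g := by
  rw [topConeRatio, topConeRatio, profileMass_smul, profileMoment_smul, Pi.smul_apply, smul_eq_mul,
    mul_pow]
  field_simp

theorem bottomConeRatio_smul (hκ : κ ≠ 0) (m : ℕ) (g : ℝ → ℝ) :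
    bottomConeRatio m (κ • g) = bottomConeRatio m g := by
  rw [bottomConeRatio, bottomConeRatio, profileMass_smul, profileMoment_smul, Pi.smul_apply,
    smul_eq_mul, mul_pow]
  field_simp

theorem one_sub_mem_Icc_iff {s : ℝ} : 1 - s ∈ Set.Icc (0 : ℝ) 1 ↔ s ∈ Set.Icc (0 : ℝ) 1 := by
  simp only [Set.mem_Icc, sub_nonneg, sub_le_self_iff, and_comm]

theorem IsProfile.comp_one_sub (hg : IsProfile m g) : IsProfile m fun s => g (1 - s) where
  nonneg s hs := hg.nonneg _ (one_sub_mem_Icc_iff.2 hs)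
  intervalIntegrable := by simpa using (hg.intervalIntegrable.comp_sub_left 1).symm

theorem concaveOn_comp_one_sub (hf : ConcaveOn ℝ (Set.Icc 0 1) f) :
    ConcaveOn ℝ (Set.Icc 0 1) fun s => f (1 - s) := by
  refine ⟨convex_Icc 0 1, fun x hx y hy a b ha hb hab => ?_⟩
  have h := hf.2 (one_sub_mem_Icc_iff.2 hx) (one_sub_mem_Icc_iff.2 hy) ha hb hab
  rwa [show a • (1 - x) + b • (1 - y) = 1 - (a • x + b • y) by
    simp only [smul_eq_mul]; linear_combination hab] at h

theorem profileMass_comp_one_sub (m : ℕ) (g : ℝ → ℝ) :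
    profileMass m (fun s => g (1 - s)) = profileMass m g := by
  simp [profileMass, intervalIntegral.integral_comp_sub_left fun s => g s ^ m]

theorem profileMoment_comp_one_sub (hg : IsProfile m g) :
    profileMoment m (fun s => g (1 - s)) = profileMass m g - profileMoment m g := by
  have h := intervalIntegral.integral_comp_sub_left (a := 0) (b := 1)
    (fun s => (1 - s) * g s ^ m) 1
  simp only [sub_sub_cancel, sub_self, sub_zero, sub_mul, one_mul] at h
  rw [profileMoment, h, intervalIntegral.integral_sub hg.intervalIntegrable
    hg.intervalIntegrable_id_mul, profileMass, profileMoment]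

theorem topConeRatio_comp_one_sub (hg : IsProfile m g) :
    topConeRatio m (fun s => g (1 - s)) = bottomConeRatio m g := by
  rw [topConeRatio, bottomConeRatio, profileMass_comp_one_sub, profileMoment_comp_one_sub hg,
    sub_sub_cancel, sub_self]

theorem bottomConeRatio_comp_one_sub (hg : IsProfile m g) :
    bottomConeRatio m (fun s => g (1 - s)) = topConeRatio m g := by
  rw [topConeRatio, bottomConeRatio, profileMass_comp_one_sub, profileMoment_comp_one_sub hg,
    sub_zero]

end Profile

section Comparison

variable {m : ℕ} {f g k : ℝ → ℝ}

theorem exists_pos_of_concaveOn (hf : ConcaveOn ℝ (Set.Icc 0 1) f) (h0 : 0 < f 0) :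
    ∃ s ∈ Set.Ioc (0 : ℝ) 1, 0 < f s := by
  have hsum : 0 < f 0 + |f 1| := by positivity
  set s := f 0 / (2 * (f 0 + |f 1|)) with hs
  have hs0 : 0 < s := by positivity
  have hs1 : s ≤ 1 := div_le_one_of_le₀ (by linarith [abs_nonneg (f 1)]) (by positivity)
  have hmul : s * (f 0 + |f 1|) = f 0 / 2 := by rw [hs]; field_simp
  have hconc := hf.2 (Set.left_mem_Icc.2 zero_le_one) (Set.right_mem_Icc.2 zero_le_one)
    (sub_nonneg.2 hs1) hs0.le (sub_add_cancel _ _)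
  simp only [smul_eq_mul, mul_zero, zero_add, mul_one] at hconc
  exact ⟨s, ⟨hs0, hs1⟩, by linarith [mul_le_mul_of_nonneg_left (neg_abs_le (f 1)) hs0.le]⟩

/-- The crossing point is the supremum of the set where `f` is positive, which is `0` if that set is
empty. -/
theorem exists_sign_change_of_concaveOn (hf : ConcaveOn ℝ (Set.Icc 0 1) f) (h0 : 0 ≤ f 0) :
    ∃ τ, (∀ s ∈ Set.Ioc (0 : ℝ) 1, s < τ → 0 < f s) ∧
      ∀ s ∈ Set.Ioc (0 : ℝ) 1, τ < s → f s ≤ 0 := by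
  set S := {s ∈ Set.Icc (0 : ℝ) 1 | 0 < f s}
  have hbdd : BddAbove S := ⟨1, fun s hs => hs.1.2⟩
  refine ⟨sSup S, fun s hs hlt => ?_, fun s hs hlt => ?_⟩
  · have hne : S.Nonempty := by
      by_contra hS
      rw [Set.not_nonempty_iff_eq_empty.1 hS, Real.sSup_empty] at hlt
      exact hlt.not_gt hs.1
    obtain ⟨t, ht, hst⟩ := exists_lt_of_lt_csSup hne hlt
    have ht0 : 0 < t := hs.1.trans hst
    have hdiv : s / t ≤ 1 := (div_le_one ht0).2 hst.le
    have hconc := hf.2 (Set.left_mem_Icc.2 zero_le_one) ht.1 (sub_nonneg.2 hdiv)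
      (div_pos hs.1 ht0).le (sub_add_cancel _ _)
    simp only [smul_eq_mul, mul_zero, zero_add, div_mul_cancel₀ _ ht0.ne'] at hconc
    have hpos : 0 < s / t * f t := mul_pos (div_pos hs.1 ht0) ht.2
    linarith [mul_nonneg (sub_nonneg.2 hdiv) h0]
  · by_contra! hpos
    exact hlt.not_ge (le_csSup hbdd ⟨⟨hs.1.le, hs.2⟩, hpos⟩)

theorem exists_crossing_weight (hm : m ≠ 0) (hg : IsProfile m g) (hk : IsProfile m k)
    (hc : ConcaveOn ℝ (Set.Icc 0 1) (g - k)) (h0 : k 0 ≤ g 0) :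
    ∃ τ : ℝ, (∀ s ∈ Set.Ioc (0 : ℝ) 1, 0 ≤ (τ - s) * (g s ^ m - k s ^ m)) ∧
      (k 0 < g 0 → 0 < τ ∧ ∀ s ∈ Set.Ioc (0 : ℝ) 1, s < τ → 0 < (τ - s) * (g s ^ m - k s ^ m)) := by
  obtain ⟨τ, hlow, hhigh⟩ := exists_sign_change_of_concaveOn hc (sub_nonneg.2 h0)
  have hpos : ∀ s ∈ Set.Ioc (0 : ℝ) 1, s < τ → 0 < (τ - s) * (g s ^ m - k s ^ m) :=
    fun s hs hlt => mul_pos (sub_pos.2 hlt) (sub_pos.2 (pow_lt_pow_left₀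
      (sub_pos.1 (hlow s hs hlt)) (hk.nonneg s ⟨hs.1.le, hs.2⟩) hm))
  refine ⟨τ, fun s hs => ?_, fun h => ⟨?_, hpos⟩⟩
  · rcases lt_trichotomy s τ with h | rfl | h
    · exact (hpos s hs h).le
    · rw [sub_self, zero_mul]
    · exact mul_nonneg_of_nonpos_of_nonpos (by linarith) (sub_nonpos.2 (pow_le_pow_left₀
        (hg.nonneg s ⟨hs.1.le, hs.2⟩) (sub_nonpos.1 (hhigh s hs h)) m))
  · obtain ⟨s, hs, hgt⟩ := exists_pos_of_concaveOn hc (sub_pos.2 h)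
    by_contra! hτ
    exact hgt.not_ge (hhigh s hs (hτ.trans_lt hs.1))

theorem integral_weight_mul_sub_eq (hg : IsProfile m g) (hk : IsProfile m k)
    (hmass : profileMass m g = profileMass m k) (τ : ℝ) :
    ∫ s in (0 : ℝ)..1, (τ - s) * (g s ^ m - k s ^ m) = profileMoment m k - profileMoment m g := by
  have hexpand : ∀ s, (τ - s) * (g s ^ m - k s ^ m) =
      τ * (g s ^ m - k s ^ m) - (s * g s ^ m - s * k s ^ m) := fun s => by ring
  simp only [hexpand]
  rw [intervalIntegral.integral_sub ((hg.intervalIntegrable.sub hk.intervalIntegrable).const_mul τ)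
      (hg.intervalIntegrable_id_mul.sub hk.intervalIntegrable_id_mul),
    intervalIntegral.integral_const_mul,
    intervalIntegral.integral_sub hg.intervalIntegrable hk.intervalIntegrable,
    intervalIntegral.integral_sub hg.intervalIntegrable_id_mul hk.intervalIntegrable_id_mul]
  simp only [profileMass, profileMoment] at hmass ⊢
  rw [hmass]
  ring

theorem profileMoment_le_of_concaveOn_sub (hm : m ≠ 0) (hg : IsProfile m g) (hk : IsProfile m k)
    (hc : ConcaveOn ℝ (Set.Icc 0 1) (g - k)) (hmass : profileMass m g = profileMass m k)
    (h0 : k 0 ≤ g 0) : profileMoment m g ≤ profileMoment m k := by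
  obtain ⟨τ, hnonneg, -⟩ := exists_crossing_weight hm hg hk hc h0
  rw [← sub_nonneg, ← integral_weight_mul_sub_eq hg hk hmass τ,
    intervalIntegral.integral_of_le zero_le_one]
  exact setIntegral_nonneg measurableSet_Ioc hnonneg

theorem profileMoment_lt_of_concaveOn_sub (hm : m ≠ 0) (hg : IsProfile m g) (hk : IsProfile m k)
    (hc : ConcaveOn ℝ (Set.Icc 0 1) (g - k)) (hmass : profileMass m g = profileMass m k)
    (h0 : k 0 < g 0) : profileMoment m g < profileMoment m k := by
  obtain ⟨τ, hnonneg, hpos⟩ := exists_crossing_weight hm hg hk hc h0.le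
  obtain ⟨hτ, hpos⟩ := hpos h0
  have hint : IntervalIntegrable (fun s => (τ - s) * (g s ^ m - k s ^ m)) volume 0 1 :=
    (hg.intervalIntegrable.sub hk.intervalIntegrable).continuousOn_mul (by fun_prop)
  rw [← sub_pos, ← integral_weight_mul_sub_eq hg hk hmass τ,
    intervalIntegral.integral_pos_iff_support_of_nonneg_ae' ?_ hint]
  · refine ⟨one_pos, ?_⟩
    have hsub : Set.Ioo 0 (min τ 1) ⊆
        Function.support (fun s => (τ - s) * (g s ^ m - k s ^ m)) ∩ Set.Ioc 0 1 := fun s hs => by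
      have hs1 : s ∈ Set.Ioc (0 : ℝ) 1 := ⟨hs.1, (hs.2.trans_le (min_le_right _ _)).le⟩
      exact ⟨(hpos s hs1 (hs.2.trans_le (min_le_left _ _))).ne', hs1⟩
    refine lt_of_lt_of_le ?_ (measure_mono hsub)
    simp [hτ]
  · rw [Set.uIoc_of_le zero_le_one]
    exact ae_restrict_of_forall_mem measurableSet_Ioc hnonneg

theorem endpoint_le_of_profileMoment_eq (hm : m ≠ 0) (hg : IsProfile m g) (hk : IsProfile m k)
    (hc : ConcaveOn ℝ (Set.Icc 0 1) (g - k)) (hmass : profileMass m g = profileMass m k)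
    (hmoment : profileMoment m g = profileMoment m k) : g 0 ≤ k 0 ∧ g 1 ≤ k 1 := by
  constructor
  · by_contra! h
    exact (profileMoment_lt_of_concaveOn_sub hm hg hk hc hmass h).ne hmoment
  · by_contra! h
    refine (profileMoment_lt_of_concaveOn_sub hm hg.comp_one_sub hk.comp_one_sub
      (concaveOn_comp_one_sub hc) ?_ (by simpa using h)).ne ?_
    · rw [profileMass_comp_one_sub, profileMass_comp_one_sub, hmass]
    · rw [profileMoment_comp_one_sub hg, profileMoment_comp_one_sub hk, hmass, hmoment]

theorem eqOn_of_profileMass_le (hm : m ≠ 0) (hg : IsProfile m g) (hc : ConcaveOn ℝ (Set.Icc 0 1) g)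
    {κ : ℝ} (hκ : 0 ≤ κ) (h0 : κ ≤ g 0) (h1 : κ ≤ g 1) (hmass : profileMass m g ≤ κ ^ m) :
    ∀ s ∈ Set.Ioo (0 : ℝ) 1, g s = κ := by
  have hle : ∀ s ∈ Set.Icc (0 : ℝ) 1, κ ≤ g s := fun s hs =>
    (le_min h0 h1).trans (hc.min_le_of_mem_Icc (Set.left_mem_Icc.2 zero_le_one)
      (Set.right_mem_Icc.2 zero_le_one) hs)
  have hnonneg : ∀ s ∈ Set.Ioc (0 : ℝ) 1, 0 ≤ g s ^ m - κ ^ m := fun s hs =>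
    sub_nonneg.2 (pow_le_pow_left₀ hκ (hle s ⟨hs.1.le, hs.2⟩) m)
  have hint := hg.intervalIntegrable.sub (intervalIntegrable_const (c := κ ^ m))
  have hzero : ∫ s in (0 : ℝ)..1, (g s ^ m - κ ^ m) = 0 := by
    refine le_antisymm ?_ ?_
    · rw [intervalIntegral.integral_sub hg.intervalIntegrable intervalIntegrable_const]
      simpa [profileMass] using hmass
    · rw [intervalIntegral.integral_of_le zero_le_one]
      exact setIntegral_nonneg measurableSet_Ioc hnonneg
  rw [intervalIntegral.integral_eq_zero_iff_of_le_of_nonneg_ae zero_le_one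
    (ae_restrict_of_forall_mem measurableSet_Ioc hnonneg) hint, ← restrict_Ioo_eq_restrict_Ioc]
    at hzero
  have hcont : ContinuousOn (fun s => g s ^ m - κ ^ m) (Set.Ioo 0 1) := by
    have := hc.continuousOn_interior
    rw [interior_Icc] at this
    fun_prop
  have heq := Measure.eqOn_open_of_ae_eq hzero isOpen_Ioo hcont continuousOn_const
  intro s hs
  exact (pow_left_inj₀ (hg.nonneg s ⟨hs.1.le, hs.2.le⟩) hκ hm).1 (sub_eq_zero.1 (heq hs))

end Comparison

section Frustum

variable {m : ℕ} {r : ℝ}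

/-- The profile of a truncated cone with faces of edge length `r` at height `0` and `1` at
height `1`. -/
def frustum (r s : ℝ) : ℝ := r + (1 - r) * s

theorem continuous_frustum (r : ℝ) : Continuous (frustum r) := by
  unfold frustum
  fun_prop

theorem isProfile_frustum (h0 : 0 ≤ r) (h1 : r ≤ 1) (m : ℕ) : IsProfile m (frustum r) where
  nonneg _ hs := add_nonneg h0 (mul_nonneg (sub_nonneg.2 h1) hs.1)
  intervalIntegrable := ((continuous_frustum r).pow m).intervalIntegrable 0 1

theorem convexOn_frustum (r : ℝ) : ConvexOn ℝ (Set.Icc 0 1) (frustum r) := by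
  refine ⟨convex_Icc 0 1, fun x _ y _ a b _ _ hab => le_of_eq ?_⟩
  simp only [frustum, smul_eq_mul]
  linear_combination -r * hab

theorem profileMass_frustum_pos (h0 : 0 ≤ r) (h1 : r ≤ 1) (m : ℕ) :
    0 < profileMass m (frustum r) :=
  intervalIntegral.intervalIntegral_pos_of_pos_on (isProfile_frustum h0 h1 m).intervalIntegrable
    (fun _ hs => pow_pos (by rw [frustum]; nlinarith [hs.1, hs.2]) m) one_pos

theorem frustum_one (s : ℝ) : frustum 1 s = 1 := by rw [frustum, sub_self, zero_mul, add_zero]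

theorem profileMass_frustum_one (m : ℕ) : profileMass m (frustum 1) = 1 := by
  simp [profileMass, frustum_one]

theorem profileMoment_frustum_one (m : ℕ) : profileMoment m (frustum 1) = 1 / 2 := by
  simp [profileMoment, frustum_one]

theorem profileMass_frustum (hr : r ≠ 1) (m : ℕ) :
    profileMass m (frustum r) = (1 - r ^ (m + 1)) / ((m + 1) * (1 - r)) := by
  have hr' : 1 - r ≠ 0 := sub_ne_zero.2 hr.symm
  simp only [profileMass, frustum]
  rw [intervalIntegral.integral_comp_add_mul (fun x => x ^ m) hr', integral_pow, smul_eq_mul,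
    mul_one, mul_zero, add_zero, add_sub_cancel, one_pow]
  field_simp

theorem profileMoment_frustum (hr : r ≠ 1) (m : ℕ) : profileMoment m (frustum r) =
    ((1 - r ^ (m + 2)) / (m + 2) - r * (1 - r ^ (m + 1)) / (m + 1)) / (1 - r) ^ 2 := by
  have hr' : 1 - r ≠ 0 := sub_ne_zero.2 hr.symm
  have hid : ∀ s, s * frustum r s ^ m =
      (frustum r s ^ (m + 1) - r * frustum r s ^ m) / (1 - r) := fun s => by
    rw [eq_div_iff hr', pow_succ', ← sub_mul, frustum]
    ring
  have hint : ∀ j, IntervalIntegrable (fun s => frustum r s ^ j) volume 0 1 := fun j =>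
    ((continuous_frustum r).pow j).intervalIntegrable 0 1
  have hmass := profileMass_frustum hr
  simp only [profileMass] at hmass
  simp only [profileMoment, hid]
  rw [intervalIntegral.integral_div, intervalIntegral.integral_sub (hint _) ((hint _).const_mul r),
    intervalIntegral.integral_const_mul, hmass, hmass]
  push_cast
  have hm : (m : ℝ) + 1 + 1 ≠ 0 := by positivity
  rw [show (m : ℝ) + 2 = m + 1 + 1 by ring]
  field_simp

theorem topConeRatio_frustum (h0 : 0 ≤ r) (h1 : r < 1) (m : ℕ) : topConeRatio m (frustum r) =
    (1 - (m + 2) * r ^ (m + 1) + (m + 1) * r ^ (m + 2)) / ((m + 2) * (1 - r ^ (m + 1)) ^ 2) := by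
  have hpow := (one_sub_pow_succ_pos h0 h1 m).ne'
  have hr := (sub_pos.2 h1).ne'
  rw [topConeRatio, profileMass_frustum h1.ne, profileMoment_frustum h1.ne, frustum]
  field_simp
  ring

theorem bottomConeRatio_frustum (h0 : 0 ≤ r) (h1 : r < 1) (m : ℕ) :
    bottomConeRatio m (frustum r) = r ^ m * (m + 1 - (m + 2) * r + r ^ (m + 2)) /
      ((m + 2) * (1 - r ^ (m + 1)) ^ 2) := by
  have hpow := (one_sub_pow_succ_pos h0 h1 m).ne'
  have hr := (sub_pos.2 h1).ne'
  rw [bottomConeRatio, profileMass_frustum h1.ne, profileMoment_frustum h1.ne, frustum]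
  field_simp
  ring

theorem succ_mul_oppositeConeSum_frustum (h0 : 0 ≤ r) (h1 : r < 1) (hm : m ≠ 0) :
    (m + 2) * oppositeConeSum (m + 1) (topConeRatio m (frustum r)) (bottomConeRatio m (frustum r)) =
      m + 2 - frustumDefect m r / (1 - r ^ (m + 1)) ^ 2 +
        (frustumGap m r / (1 - r ^ (m + 1)) ^ 2) ^ (m + 1) := by
  have hpow := one_sub_pow_succ_pos h0 h1 m
  have hgap := frustumGap_pos h0 h1 hm
  have hsub : topConeRatio m (frustum r) - bottomConeRatio m (frustum r) =
      frustumGap m r / (1 - r ^ (m + 1)) ^ 2 / (m + 2) := by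
    rw [topConeRatio_frustum h0 h1, bottomConeRatio_frustum h0 h1, frustumGap]
    field_simp
    ring
  have hadd : (m + 1) * (m + 2) * (topConeRatio m (frustum r) + bottomConeRatio m (frustum r)) =
      m + 2 - frustumDefect m r / (1 - r ^ (m + 1)) ^ 2 := by
    rw [topConeRatio_frustum h0 h1, bottomConeRatio_frustum h0 h1, frustumDefect]
    field_simp
    ring
  have h := succ_mul_oppositeConeSum (Nat.add_one_ne_zero m) (topConeRatio m (frustum r))
    (bottomConeRatio m (frustum r))
  rw [hsub, abs_of_pos (by positivity)] at h
  push_cast at h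
  rw [add_assoc (m : ℝ) 1 1, one_add_one_eq_two, mul_div_cancel₀ _ (by positivity)] at h
  rw [h, ← hadd]
  ring

theorem oppositeConeSum_frustum_zero (hm : m ≠ 0) :
    oppositeConeSum (m + 1) (topConeRatio m (frustum 0)) (bottomConeRatio m (frustum 0)) = 1 := by
  refine mul_left_cancel₀ (by positivity : (m : ℝ) + 2 ≠ 0) ?_
  rw [succ_mul_oppositeConeSum_frustum le_rfl one_pos hm]
  simp [frustumDefect, frustumGap, hm]

theorem oppositeConeSum_frustum_one (hm : m ≠ 0) :
    oppositeConeSum (m + 1) (topConeRatio m (frustum 1)) (bottomConeRatio m (frustum 1)) = 1 := by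
  rw [oppositeConeSum, topConeRatio, bottomConeRatio, profileMass_frustum_one,
    profileMoment_frustum_one, frustum_one, frustum_one, sub_half, sub_self, abs_zero,
    zero_pow m.succ_ne_zero, one_pow]
  push_cast
  field_simp
  norm_num

theorem oppositeConeSum_frustum_lt (h0 : 0 < r) (h1 : r < 1) (hm : 2 ≤ m) :
    oppositeConeSum (m + 1) (topConeRatio m (frustum r)) (bottomConeRatio m (frustum r)) < 1 := by
  have hpow := one_sub_pow_succ_pos h0.le h1 m
  refine lt_of_mul_lt_mul_left ?_ (by positivity : (0 : ℝ) ≤ m + 2)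
  rw [succ_mul_oppositeConeSum_frustum h0.le h1 (by omega)]
  have hlt : (frustumGap m r / (1 - r ^ (m + 1)) ^ 2) ^ (m + 1) <
      frustumDefect m r / (1 - r ^ (m + 1)) ^ 2 := by
    rw [div_pow, div_lt_div_iff₀ (by positivity) (by positivity), pow_succ (_ ^ 2) m, ← mul_assoc]
    exact mul_lt_mul_of_pos_right (frustumGap_pow_lt h0 h1 hm) (by positivity)
  linarith

theorem oppositeConeSum_frustum_le (h0 : 0 ≤ r) (h1 : r ≤ 1) (hm : 2 ≤ m) :
    oppositeConeSum (m + 1) (topConeRatio m (frustum r)) (bottomConeRatio m (frustum r)) ≤ 1 ∧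
      (oppositeConeSum (m + 1) (topConeRatio m (frustum r)) (bottomConeRatio m (frustum r)) = 1 →
        r = 0 ∨ r = 1) := by
  have hm0 : m ≠ 0 := by omega
  rcases h0.eq_or_lt with rfl | h0
  · exact ⟨(oppositeConeSum_frustum_zero hm0).le, fun _ => Or.inl rfl⟩
  rcases h1.eq_or_lt with rfl | h1
  · exact ⟨(oppositeConeSum_frustum_one hm0).le, fun _ => Or.inr rfl⟩
  have hlt := oppositeConeSum_frustum_lt h0 h1 hm
  exact ⟨hlt.le, fun heq => absurd heq hlt.ne⟩

end Frustum

section ConcaveProfile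

variable {m : ℕ} {g : ℝ → ℝ} {κ r : ℝ}

theorem concaveOn_sub_smul_frustum (hc : ConcaveOn ℝ (Set.Icc 0 1) g) (hκ : 0 ≤ κ) (r : ℝ) :
    ConcaveOn ℝ (Set.Icc 0 1) (g - κ • frustum r) :=
  hc.sub ((convexOn_frustum r).smul hκ)

theorem exists_pos_pow_eq (hm : m ≠ 0) {v : ℝ} (hv : 0 < v) : ∃ κ, 0 < κ ∧ κ ^ m = v :=
  ⟨v ^ (m⁻¹ : ℝ), by positivity, Real.rpow_inv_natCast_pow hv.le hm⟩

/-- The centroid of a body with concave profile is at most as high as that of a cone with apex at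
height `0`. -/
theorem profileMoment_le_mul_profileMass (hm : m ≠ 0) (hg : IsProfile m g)
    (hc : ConcaveOn ℝ (Set.Icc 0 1) g) (hpos : 0 < profileMass m g) :
    profileMoment m g ≤ (m + 1) / (m + 2) * profileMass m g := by
  obtain ⟨κ, hκ0, hκ⟩ := exists_pos_pow_eq hm (mul_pos (by positivity : 0 < (m : ℝ) + 1) hpos)
  have hle := profileMoment_le_of_concaveOn_sub hm hg ((isProfile_frustum le_rfl zero_le_one m).smul
    hκ0.le) (concaveOn_sub_smul_frustum hc hκ0.le 0) ?_ ?_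
  · rw [profileMoment_smul, profileMoment_frustum zero_ne_one, hκ] at hle
    refine hle.trans_eq ?_
    simp only [ne_eq, Nat.add_eq_zero_iff, OfNat.ofNat_ne_zero, and_false, not_false_eq_true,
      zero_pow, sub_zero, one_div, one_ne_zero, mul_one, zero_div, one_pow, div_one]
    ring
  · rw [profileMass_smul, profileMass_frustum zero_ne_one, hκ]
    simp only [ne_eq, Nat.add_eq_zero_iff, one_ne_zero, and_false, not_false_eq_true, zero_pow,
      sub_zero, mul_one, one_div]
    field_simp
  · simpa [frustum] using hg.nonneg 0 (Set.left_mem_Icc.2 zero_le_one)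

theorem exists_frustum_moment_div_mass_eq (hm : m ≠ 0) {q : ℝ} (hq0 : 1 / 2 ≤ q)
    (hq1 : q ≤ (m + 1) / (m + 2)) : ∃ r ∈ Set.Icc (0 : ℝ) 1,
      profileMoment m (frustum r) / profileMass m (frustum r) = q := by
  have hcont : ContinuousOn (fun r => profileMoment m (frustum r) / profileMass m (frustum r))
      (Set.Icc 0 1) := by
    refine ContinuousOn.div ?_ ?_ fun r hr => (profileMass_frustum_pos hr.1 hr.2 m).ne'
    · exact (intervalIntegral.continuous_parametric_intervalIntegral_of_continuous'
        (f := fun r s : ℝ => s * (r + (1 - r) * s) ^ m) (by fun_prop) 0 1).continuousOn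
    · exact (intervalIntegral.continuous_parametric_intervalIntegral_of_continuous'
        (f := fun r s : ℝ => (r + (1 - r) * s) ^ m) (by fun_prop) 0 1).continuousOn
  refine intermediate_value_Icc' zero_le_one hcont ⟨?_, ?_⟩
  · rwa [profileMass_frustum_one, profileMoment_frustum_one, div_one]
  · refine hq1.trans_eq ?_
    rw [profileMass_frustum zero_ne_one, profileMoment_frustum zero_ne_one]
    simp only [ne_eq, Nat.add_eq_zero_iff, OfNat.ofNat_ne_zero, and_false, not_false_eq_true,
      zero_pow, sub_zero, one_div, one_ne_zero, mul_one, zero_div, one_pow, div_one,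
      div_inv_eq_mul]
    field_simp

theorem exists_frustum_endpoint_le (hm : m ≠ 0) (hg : IsProfile m g)
    (hc : ConcaveOn ℝ (Set.Icc 0 1) g) (hpos : 0 < profileMass m g)
    (hhalf : profileMass m g / 2 ≤ profileMoment m g) :
    ∃ r ∈ Set.Icc (0 : ℝ) 1, ∃ κ, 0 < κ ∧ profileMass m g = profileMass m (κ • frustum r) ∧
      profileMoment m g = profileMoment m (κ • frustum r) ∧ g 0 ≤ κ * r ∧ g 1 ≤ κ := by
  obtain ⟨r, hr, hquot⟩ := exists_frustum_moment_div_mass_eq hm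
    (by rwa [le_div_iff₀ hpos, div_mul_eq_mul_div, one_mul])
    ((div_le_iff₀ hpos).2 (profileMoment_le_mul_profileMass hm hg hc hpos))
  have hpos' := profileMass_frustum_pos hr.1 hr.2 m
  obtain ⟨κ, hκ0, hκ⟩ := exists_pos_pow_eq hm (div_pos hpos hpos')
  have hmass : profileMass m g = profileMass m (κ • frustum r) := by
    rw [profileMass_smul, hκ, div_mul_cancel₀ _ hpos'.ne']
  have hmoment : profileMoment m g = profileMoment m (κ • frustum r) := by
    rw [div_eq_div_iff hpos'.ne' hpos.ne'] at hquot
    rw [profileMoment_smul, hκ, div_mul_eq_mul_div, eq_div_iff hpos'.ne']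
    linarith
  have hends := endpoint_le_of_profileMoment_eq hm hg ((isProfile_frustum hr.1 hr.2 m).smul hκ0.le)
    (concaveOn_sub_smul_frustum hc hκ0.le r) hmass hmoment
  simp only [Pi.smul_apply, frustum, smul_eq_mul, mul_zero, add_zero, mul_one,
    add_sub_cancel] at hends
  exact ⟨r, hr, κ, hκ0, hmass, hmoment, hends⟩

theorem topConeRatio_mono {k : ℝ → ℝ} (hm : m ≠ 0) (hg : IsProfile m g)
    (hmass : profileMass m g = profileMass m k) (hmoment : profileMoment m g = profileMoment m k)
    (hlt : profileMoment m g < profileMass m g) (hpos : 0 < profileMass m g) (h1 : g 1 ≤ k 1) :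
    0 ≤ topConeRatio m g ∧ topConeRatio m g ≤ topConeRatio m k ∧
      (topConeRatio m g = topConeRatio m k → g 1 = k 1) := by
  have hg1 := hg.nonneg 1 (Set.right_mem_Icc.2 zero_le_one)
  have hsub := sub_pos.2 hlt
  rw [topConeRatio, topConeRatio, ← hmass, ← hmoment]
  refine ⟨by positivity, by gcongr, fun heq => ?_⟩
  rw [div_left_inj' (by positivity), mul_right_inj' hsub.ne'] at heq
  exact (pow_left_inj₀ hg1 (hg1.trans h1) hm).1 heq

theorem bottomConeRatio_mono {k : ℝ → ℝ} (hm : m ≠ 0) (hg : IsProfile m g)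
    (hmass : profileMass m g = profileMass m k) (hmoment : profileMoment m g = profileMoment m k)
    (hmoment_pos : 0 < profileMoment m g) (hpos : 0 < profileMass m g) (h0 : g 0 ≤ k 0) :
    0 ≤ bottomConeRatio m g ∧ bottomConeRatio m g ≤ bottomConeRatio m k ∧
      (bottomConeRatio m g = bottomConeRatio m k → g 0 = k 0) := by
  have hg0 := hg.nonneg 0 (Set.left_mem_Icc.2 zero_le_one)
  rw [bottomConeRatio, bottomConeRatio, ← hmass, ← hmoment]
  refine ⟨by positivity, by gcongr, fun heq => ?_⟩
  rw [div_left_inj' (by positivity), mul_right_inj' hmoment_pos.ne'] at heq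
  exact (pow_left_inj₀ hg0 (hg0.trans h0) hm).1 heq

theorem oppositeConeSum_profile_le_of_half_le (hm : 2 ≤ m) (hg : IsProfile m g)
    (hc : ConcaveOn ℝ (Set.Icc 0 1) g) (hpos : 0 < profileMass m g)
    (hhalf : profileMass m g / 2 ≤ profileMoment m g) :
    oppositeConeSum (m + 1) (topConeRatio m g) (bottomConeRatio m g) ≤ 1 ∧
      (oppositeConeSum (m + 1) (topConeRatio m g) (bottomConeRatio m g) = 1 →
        (g 0 = g 1 ∧ profileMass m g = g 1 ^ m) ∨
          (g 0 = 0 ∧ profileMass m g = g 1 ^ m / (m + 1))) := by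
  have hm0 : m ≠ 0 := by omega
  obtain ⟨r, hr, κ, hκ0, hmass, hmoment, h0, h1⟩ :=
    exists_frustum_endpoint_le hm0 hg hc hpos hhalf
  have hlt : profileMoment m g < profileMass m g := by
    refine (profileMoment_le_mul_profileMass hm0 hg hc hpos).trans_lt
      (mul_lt_of_lt_one_left hpos ?_)
    rw [div_lt_one (by positivity)]
    linarith
  obtain ⟨htop0, htop, htop_eq⟩ := topConeRatio_mono hm0 hg hmass hmoment hlt hpos
    (by simpa [frustum] using h1)
  obtain ⟨hbot0, hbot, hbot_eq⟩ := bottomConeRatio_mono hm0 hg hmass hmoment (by linarith) hpos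
    (by simpa [frustum] using h0)
  rw [topConeRatio_smul hκ0.ne'] at htop htop_eq
  rw [bottomConeRatio_smul hκ0.ne'] at hbot hbot_eq
  simp only [Pi.smul_apply, frustum, smul_eq_mul, mul_zero, add_zero, mul_one, add_sub_cancel]
    at htop_eq hbot_eq
  obtain ⟨hfrustum, hfrustum_eq⟩ := oppositeConeSum_frustum_le hr.1 hr.2 hm
  obtain ⟨hmono, hmono_eq⟩ := oppositeConeSum_mono (by omega) htop0 hbot0 htop hbot hfrustum
  refine ⟨hmono.trans hfrustum, fun heq => ?_⟩
  have heq' := le_antisymm hfrustum (heq.symm.trans_le hmono)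
  obtain ⟨htop, hbot⟩ := hmono_eq (heq.trans heq'.symm)
  rw [hbot_eq hbot, htop_eq htop, hmass, profileMass_smul]
  rcases hfrustum_eq heq' with rfl | rfl
  · right
    rw [profileMass_frustum zero_ne_one, zero_pow m.succ_ne_zero, sub_zero, mul_one, mul_one_div]
    exact ⟨mul_zero κ, rfl⟩
  · left
    rw [profileMass_frustum_one]
    exact ⟨mul_one κ, mul_one _⟩

theorem oppositeConeSum_profile_le (hm : 2 ≤ m) (hg : IsProfile m g)
    (hc : ConcaveOn ℝ (Set.Icc 0 1) g) (hpos : 0 < profileMass m g) :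
    oppositeConeSum (m + 1) (topConeRatio m g) (bottomConeRatio m g) ≤ 1 ∧
      (oppositeConeSum (m + 1) (topConeRatio m g) (bottomConeRatio m g) = 1 →
        (g 0 = g 1 ∧ profileMass m g = g 1 ^ m) ∨
          (g 0 = 0 ∧ profileMass m g = g 1 ^ m / (m + 1)) ∨
            (g 1 = 0 ∧ profileMass m g = g 0 ^ m / (m + 1))) := by
  rcases le_total (profileMass m g / 2) (profileMoment m g) with h | h
  · obtain ⟨hle, heq⟩ := oppositeConeSum_profile_le_of_half_le hm hg hc hpos h
    exact ⟨hle, fun h => (heq h).imp_right Or.inl⟩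
  · have hreflect := oppositeConeSum_profile_le_of_half_le hm hg.comp_one_sub
      (concaveOn_comp_one_sub hc) (by rwa [profileMass_comp_one_sub])
      (by rw [profileMass_comp_one_sub, profileMoment_comp_one_sub hg]; linarith)
    rw [topConeRatio_comp_one_sub hg, bottomConeRatio_comp_one_sub hg, oppositeConeSum_comm,
      profileMass_comp_one_sub, sub_zero, sub_self] at hreflect
    refine ⟨hreflect.1, fun h => (hreflect.2 h).imp (fun ⟨hends, hmass⟩ => ?_) Or.inr⟩
    exact ⟨hends.symm, hends ▸ hmass⟩

end ConcaveProfile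

theorem isCompact_convexHull_union {E : Type*} [NormedAddCommGroup E] [NormedSpace ℝ E]
    {S T : Set E} (hS : IsCompact S) (hT : IsCompact T) (cS : Convex ℝ S) (cT : Convex ℝ T)
    (nS : S.Nonempty) (nT : T.Nonempty) : IsCompact (convexHull ℝ (S ∪ T)) := by
  have himage : convexHull ℝ (S ∪ T) = (fun q : ℝ × E × E => (1 - q.1) • q.2.1 + q.1 • q.2.2) ''
      (Set.Icc 0 1 ×ˢ S ×ˢ T) := by
    rw [cS.convexHull_union cT nS nT]
    ext x
    simp only [mem_convexJoin, segment_eq_image, Set.mem_image, Set.mem_prod, Prod.exists]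
    constructor
    · rintro ⟨a, ha, b, hb, r, hr, rfl⟩
      exact ⟨r, a, b, ⟨hr, ha, hb⟩, rfl⟩
    · rintro ⟨r, a, b, ⟨hr, ha, hb⟩, rfl⟩
      exact ⟨a, ha, b, hb, r, hr, rfl⟩
  rw [himage]
  exact (isCompact_Icc.prod (hS.prod hT)).image (by fun_prop)

theorem integral_eq_mul_integral_zero_one {α β : ℝ} (hαβ : α ≤ β) {f : ℝ → ℝ}
    (hf : ∀ t ∉ Set.Icc α β, f t = 0) :
    ∫ t, f t = (β - α) * ∫ s in (0 : ℝ)..1, f (α + (β - α) * s) := by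
  rw [intervalIntegral.mul_integral_comp_add_mul, mul_zero, add_zero, mul_one, add_sub_cancel,
    intervalIntegral.integral_of_le hαβ, ← integral_Icc_eq_integral_Ioc,
    setIntegral_eq_integral_of_forall_compl_eq_zero hf]

section SlabBody

variable {F : Type*} [NormedAddCommGroup F] [NormedSpace ℝ F] {C : Set (ℝ × F)} {α β : ℝ}

/-- A compact convex subset of `ℝ × F` whose projection to the first coordinate, its height, is
the interval `[α, β]`. -/
structure IsSlabBody (C : Set (ℝ × F)) (α β : ℝ) : Prop where
  isCompact : IsCompact C
  convex : Convex ℝ C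
  fst_mem : ∀ p ∈ C, p.1 ∈ Set.Icc α β
  bottom_nonempty : (Prod.mk α ⁻¹' C).Nonempty
  top_nonempty : (Prod.mk β ⁻¹' C).Nonempty

/-- The convex hull of a set `A` placed at height `α` and a set `B` placed at height `β`. -/
def slabHull (α β : ℝ) (A B : Set F) : Set (ℝ × F) :=
  convexHull ℝ ({α} ×ˢ A ∪ {β} ×ˢ B)

theorem slabHull_comm (α β : ℝ) (A B : Set F) : slabHull α β A B = slabHull β α B A := by
  rw [slabHull, Set.union_comm, slabHull]

theorem subset_bottom_slabHull (α β : ℝ) (A B : Set F) : A ⊆ Prod.mk α ⁻¹' slabHull α β A B :=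
  fun _ hx => subset_convexHull ℝ _ (Or.inl ⟨rfl, hx⟩)

theorem subset_top_slabHull (α β : ℝ) (A B : Set F) : B ⊆ Prod.mk β ⁻¹' slabHull α β A B :=
  fun _ hx => subset_convexHull ℝ _ (Or.inr ⟨rfl, hx⟩)

theorem slabHull_subset {A B : Set F} (hC : Convex ℝ C) (hA : A ⊆ Prod.mk α ⁻¹' C)
    (hB : B ⊆ Prod.mk β ⁻¹' C) : slabHull α β A B ⊆ C := by
  refine convexHull_min ?_ hC
  rintro ⟨_, x⟩ (⟨rfl, hx⟩ | ⟨rfl, hx⟩)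
  · exact hA hx
  · exact hB hx

theorem isSlabBody_slabHull {A B : Set F} (hαβ : α ≤ β) (hA : IsCompact A) (hB : IsCompact B)
    (cA : Convex ℝ A) (cB : Convex ℝ B) (nA : A.Nonempty) (nB : B.Nonempty) :
    IsSlabBody (slabHull α β A B) α β where
  isCompact := isCompact_convexHull_union (isCompact_singleton.prod hA)
    (isCompact_singleton.prod hB) ((convex_singleton α).prod cA) ((convex_singleton β).prod cB)
    ((Set.singleton_nonempty α).prod nA) ((Set.singleton_nonempty β).prod nB)
  convex := convex_convexHull ℝ _
  fst_mem := slabHull_subset (C := Prod.fst ⁻¹' Set.Icc α β)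
    ((convex_Icc α β).linear_preimage (LinearMap.fst ℝ ℝ F))
    (fun _ _ => Set.left_mem_Icc.2 hαβ) fun _ _ => Set.right_mem_Icc.2 hαβ
  bottom_nonempty := nA.mono (subset_bottom_slabHull α β A B)
  top_nonempty := nB.mono (subset_top_slabHull α β A B)

open scoped Pointwise in
theorem smul_slice_add_smul_slice_subset_slice (hC : Convex ℝ C) {a b : ℝ} (ha : 0 ≤ a)
    (hb : 0 ≤ b) (hab : a + b = 1) (t u : ℝ) :
    a • (Prod.mk t ⁻¹' C) + b • (Prod.mk u ⁻¹' C) ⊆ Prod.mk (a * t + b * u) ⁻¹' C :=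
  (smul_slice_add_smul_slice_subset C C a b t u).trans
    (Set.preimage_mono (hC.set_combo_subset ha hb hab))

namespace IsSlabBody

theorem le (h : IsSlabBody C α β) : α ≤ β :=
  let ⟨_, hx⟩ := h.bottom_nonempty
  (h.fst_mem _ hx).2

theorem slice_nonempty (h : IsSlabBody C α β) {s : ℝ} (hs : s ∈ Set.Icc (0 : ℝ) 1) :
    (Prod.mk (α + (β - α) * s) ⁻¹' C).Nonempty := by
  have hcombo := smul_slice_add_smul_slice_subset_slice h.convex (sub_nonneg.2 hs.2) hs.1
    (sub_add_cancel 1 s) α β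
  rw [show (1 - s) * α + s * β = α + (β - α) * s by ring] at hcombo
  exact (h.bottom_nonempty.smul_set.add h.top_nonempty.smul_set).mono hcombo

theorem sliceVolume_eq_zero [MeasureSpace F] (h : IsSlabBody C α β) {t : ℝ}
    (ht : t ∉ Set.Icc α β) : sliceVolume C t = 0 := by
  have hempty : Prod.mk t ⁻¹' C = ∅ :=
    Set.eq_empty_of_forall_notMem fun y hy => ht (h.fst_mem _ hy)
  rw [sliceVolume, hempty, measureReal_empty]

end IsSlabBody

end SlabBody

section SliceProfile

variable {m : ℕ} {C : Set (ℝ × (Fin m → ℝ))} {α β a b : ℝ}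

/-- The `m`-th root of the volume of the slices of `C`, with the heights `[α, β]` rescaled to
`[0, 1]`. -/
noncomputable def sliceProfile (C : Set (ℝ × (Fin m → ℝ))) (α β s : ℝ) : ℝ :=
  sliceVolume C (α + (β - α) * s) ^ (m⁻¹ : ℝ)

theorem sliceProfile_nonneg (C : Set (ℝ × (Fin m → ℝ))) (α β s : ℝ) :
    0 ≤ sliceProfile C α β s :=
  Real.rpow_nonneg (sliceVolume_nonneg C _) _

theorem sliceProfile_pow (hm : m ≠ 0) (C : Set (ℝ × (Fin m → ℝ))) (α β s : ℝ) :
    sliceProfile C α β s ^ m = sliceVolume C (α + (β - α) * s) :=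
  Real.rpow_inv_natCast_pow (sliceVolume_nonneg C _) hm

theorem sliceProfile_zero_pow (hm : m ≠ 0) (C : Set (ℝ × (Fin m → ℝ))) (α β : ℝ) :
    sliceProfile C α β 0 ^ m = sliceVolume C α := by
  rw [sliceProfile_pow hm, mul_zero, add_zero]

theorem sliceProfile_one_pow (hm : m ≠ 0) (C : Set (ℝ × (Fin m → ℝ))) (α β : ℝ) :
    sliceProfile C α β 1 ^ m = sliceVolume C β := by
  rw [sliceProfile_pow hm, mul_one, add_sub_cancel]

theorem isProfile_sliceProfile (hm : m ≠ 0) (hC : IsCompact C) (α β : ℝ) :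
    IsProfile m (sliceProfile C α β) where
  nonneg s _ := sliceProfile_nonneg C α β s
  intervalIntegrable := by
    simp only [sliceProfile_pow hm]
    rcases eq_or_ne (β - α) 0 with h | h
    · simp only [h, zero_mul]
      exact intervalIntegrable_const
    · exact (((integrable_sliceVolume hC).comp_add_left α).comp_mul_left' h).intervalIntegrable

/-- Brunn's theorem. -/
theorem concaveOn_sliceProfile (hm : m ≠ 0) (h : IsSlabBody C α β) :
    ConcaveOn ℝ (Set.Icc 0 1) (sliceProfile C α β) := by
  refine concaveOn_iff_forall_pos.2 ⟨convex_Icc 0 1, fun x hx y hy a b ha hb hab => ?_⟩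
  have hcombo := smul_slice_add_smul_slice_subset_slice h.convex ha.le hb.le hab
    (α + (β - α) * x) (α + (β - α) * y)
  rw [show a * (α + (β - α) * x) + b * (α + (β - α) * y) = α + (β - α) * (a • x + b • y) by
    simp only [smul_eq_mul]; linear_combination α * hab] at hcombo
  exact (brunn_minkowski hm (isCompact_slice h.isCompact _) (isCompact_slice h.isCompact _)
    (h.slice_nonempty hx) (h.slice_nonempty hy) ha hb).trans
    (Real.rpow_le_rpow measureReal_nonneg
      (measureReal_mono hcombo (isCompact_slice h.isCompact _).measure_ne_top) (by positivity))

theorem volume_real_eq_mul_profileMass (hm : m ≠ 0) (h : IsSlabBody C α β) :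
    volume.real C = (β - α) * profileMass m (sliceProfile C α β) := by
  rw [volume_real_eq_integral_sliceVolume h.isCompact,
    integral_eq_mul_integral_zero_one h.le fun t ht => h.sliceVolume_eq_zero ht]
  simp only [profileMass, sliceProfile_pow hm]

theorem setIntegral_fst_eq_mul_profileMoment (hm : m ≠ 0) (h : IsSlabBody C α β) :
    ∫ p in C, p.1 = (β - α) * (α * profileMass m (sliceProfile C α β) +
      (β - α) * profileMoment m (sliceProfile C α β)) := by
  have hg := isProfile_sliceProfile hm h.isCompact α β
  rw [setIntegral_fst_eq_integral_sliceVolume h.isCompact,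
    integral_eq_mul_integral_zero_one h.le fun t ht => by rw [h.sliceVolume_eq_zero ht, mul_zero],
    profileMass, profileMoment, ← intervalIntegral.integral_const_mul α,
    ← intervalIntegral.integral_const_mul (β - α) fun s => s * sliceProfile C α β s ^ m,
    ← intervalIntegral.integral_add (hg.intervalIntegrable.const_mul _)
      (hg.intervalIntegrable_id_mul.const_mul _)]
  simp only [sliceProfile_pow hm, add_mul, mul_assoc]

theorem lt_of_volume_real_pos (hm : m ≠ 0) (h : IsSlabBody C α β) (hpos : 0 < volume.real C) :
    α < β := by
  refine h.le.lt_of_ne ?_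
  rintro rfl
  rw [volume_real_eq_mul_profileMass hm h, sub_self, zero_mul] at hpos
  exact lt_irrefl 0 hpos

theorem profileMass_sliceProfile_pos (hm : m ≠ 0) (h : IsSlabBody C α β)
    (hpos : 0 < volume.real C) : 0 < profileMass m (sliceProfile C α β) := by
  rw [volume_real_eq_mul_profileMass hm h] at hpos
  exact pos_of_mul_pos_right hpos (sub_nonneg.2 h.le)

theorem profileMoment_sliceProfile (hm : m ≠ 0) (h : IsSlabBody C α β) (hpos : 0 < volume.real C)
    (hcen : ∫ p in C, p.1 = 0) : (β - α) * profileMoment m (sliceProfile C α β) =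
      -α * profileMass m (sliceProfile C α β) := by
  rw [setIntegral_fst_eq_mul_profileMoment hm h] at hcen
  have hlt := lt_of_volume_real_pos hm h hpos
  linarith [(mul_eq_zero.1 hcen).resolve_left (sub_pos.2 hlt).ne']

theorem topConeRatio_sliceProfile (hm : m ≠ 0) (h : IsSlabBody C α β) (hpos : 0 < volume.real C)
    (hcen : ∫ p in C, p.1 = 0) : topConeRatio m (sliceProfile C α β) =
      β * sliceVolume C β / ((m + 1) * volume.real C) := by
  have hlt := sub_pos.2 (lt_of_volume_real_pos hm h hpos)
  have hmass := profileMass_sliceProfile_pos hm h hpos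
  rw [topConeRatio, sliceProfile_one_pow hm, volume_real_eq_mul_profileMass hm h,
    div_eq_div_iff (by positivity) (by positivity)]
  linear_combination (-(sliceVolume C β) * (m + 1) * profileMass m (sliceProfile C α β)) *
    profileMoment_sliceProfile hm h hpos hcen

theorem bottomConeRatio_sliceProfile (hm : m ≠ 0) (h : IsSlabBody C α β)
    (hpos : 0 < volume.real C) (hcen : ∫ p in C, p.1 = 0) :
    bottomConeRatio m (sliceProfile C α β) =
      -α * sliceVolume C α / ((m + 1) * volume.real C) := by
  have hlt := sub_pos.2 (lt_of_volume_real_pos hm h hpos)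
  have hmass := profileMass_sliceProfile_pos hm h hpos
  rw [bottomConeRatio, sliceProfile_zero_pow hm, volume_real_eq_mul_profileMass hm h,
    div_eq_div_iff (by positivity) (by positivity)]
  linear_combination (sliceVolume C α * (m + 1) * profileMass m (sliceProfile C α β)) *
    profileMoment_sliceProfile hm h hpos hcen

theorem mul_profileMass_le_volume_real (hm : m ≠ 0) (h : IsSlabBody C α β) (ha : 0 ≤ a)
    (hb : 0 ≤ b) (haC : a ^ m ≤ sliceVolume C α) (hbC : b ^ m ≤ sliceVolume C β) :
    (β - α) * profileMass m (fun s => (1 - s) * a + s * b) ≤ volume.real C := by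
  have ha' : a ≤ sliceProfile C α β 0 := by
    rw [← sliceProfile_zero_pow hm] at haC
    exact le_of_pow_le_pow_left₀ hm (sliceProfile_nonneg C α β 0) haC
  have hb' : b ≤ sliceProfile C α β 1 := by
    rw [← sliceProfile_one_pow hm] at hbC
    exact le_of_pow_le_pow_left₀ hm (sliceProfile_nonneg C α β 1) hbC
  rw [volume_real_eq_mul_profileMass hm h]
  refine mul_le_mul_of_nonneg_left (intervalIntegral.integral_mono_on zero_le_one
    (Continuous.intervalIntegrable (by fun_prop) _ _)
    (isProfile_sliceProfile hm h.isCompact α β).intervalIntegrable fun s hs => ?_)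
    (sub_nonneg.2 h.le)
  have hs' : 0 ≤ 1 - s := sub_nonneg.2 hs.2
  have hs0 := hs.1
  refine pow_le_pow_left₀ (by positivity) ?_ m
  calc (1 - s) * a + s * b
      ≤ (1 - s) * sliceProfile C α β 0 + s * sliceProfile C α β 1 := by gcongr
    _ ≤ sliceProfile C α β ((1 - s) • 0 + s • 1) :=
        (concaveOn_sliceProfile hm h).2 (by simp) (by simp) hs' hs0 (by ring)
    _ = sliceProfile C α β s := by simp

theorem eq_slabHull_of_volume_le (hm : m ≠ 0) (h : IsSlabBody C α β) (hpos : 0 < volume.real C)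
    {A B : Set (Fin m → ℝ)} (hA : IsCompact A) (hB : IsCompact B) (cA : Convex ℝ A)
    (cB : Convex ℝ B) (nA : A.Nonempty) (nB : B.Nonempty) (hAC : A ⊆ Prod.mk α ⁻¹' C)
    (hBC : B ⊆ Prod.mk β ⁻¹' C) (ha : 0 ≤ a) (hb : 0 ≤ b) (haA : a ^ m ≤ volume.real A)
    (hbB : b ^ m ≤ volume.real B)
    (hV : volume.real C ≤ (β - α) * profileMass m (fun s => (1 - s) * a + s * b)) :
    C = slabHull α β A B := by
  have hD := isSlabBody_slabHull h.le hA hB cA cB nA nB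
  have hCD : volume.real C ≤ volume.real (slabHull α β A B) :=
    hV.trans <| mul_profileMass_le_volume_real hm hD ha hb
      (haA.trans (measureReal_mono (subset_bottom_slabHull α β A B)
        (isCompact_slice hD.isCompact α).measure_ne_top))
      (hbB.trans (measureReal_mono (subset_top_slabHull α β A B)
        (isCompact_slice hD.isCompact β).measure_ne_top))
  exact (eq_of_isClosed_of_subset_convex volume h.convex
    (nonempty_interior_of_convex_of_measureReal_pos (volume.prod volume) h.convex hpos)
    hD.isCompact.isClosed
    (slabHull_subset h.convex hAC hBC) h.isCompact.measure_ne_top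
    ((ENNReal.toReal_le_toReal h.isCompact.measure_ne_top hD.isCompact.measure_ne_top).1
      hCD)).symm

/-- `C` is an oblique prism over a convex body in `{α} × ℝᵐ`, with its top in `{β} × ℝᵐ`. -/
def IsPrismBetween (C : Set (ℝ × (Fin m → ℝ))) (α β : ℝ) : Prop :=
  ∃ (A : Set (Fin m → ℝ)) (v : Fin m → ℝ), IsCompact A ∧ Convex ℝ A ∧ 0 < volume.real A ∧
    C = slabHull α β A ((fun x => x + v) '' A)

/-- `C` is a cone over a convex body in `{α} × ℝᵐ`, with its apex in `{β} × ℝᵐ`. -/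
def IsConeBetween (C : Set (ℝ × (Fin m → ℝ))) (α β : ℝ) : Prop :=
  ∃ (A : Set (Fin m → ℝ)) (z : Fin m → ℝ), IsCompact A ∧ Convex ℝ A ∧ 0 < volume.real A ∧
    C = slabHull α β A {z}

/-- A constant profile has equal bottom, top and middle slices, which is the equality case of the
Brunn–Minkowski inequality. -/
theorem isPrismBetween_of_profileMass_eq (hm : m ≠ 0) (h : IsSlabBody C α β)
    (hpos : 0 < volume.real C) (h01 : sliceProfile C α β 0 = sliceProfile C α β 1)
    (hmass : profileMass m (sliceProfile C α β) = sliceProfile C α β 1 ^ m) :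
    IsPrismBetween C α β := by
  have hbottom : sliceVolume C α = profileMass m (sliceProfile C α β) := by
    rw [hmass, ← h01, sliceProfile_zero_pow hm]
  have htop : sliceVolume C β = profileMass m (sliceProfile C α β) := by
    rw [hmass, sliceProfile_one_pow hm]
  have hmiddle : sliceVolume C (1 / 2 * α + 1 / 2 * β) = profileMass m (sliceProfile C α β) := by
    rw [hmass, ← eqOn_of_profileMass_le hm (isProfile_sliceProfile hm h.isCompact α β)
      (concaveOn_sliceProfile hm h) (sliceProfile_nonneg C α β 1) h01.ge le_rfl hmass.le
      (1 / 2) (by norm_num), sliceProfile_pow hm]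
    congr 1
    ring
  have hA := isCompact_slice h.isCompact α
  have cA := convex_slice h.convex α
  have hA0 : 0 < sliceVolume C α := hbottom ▸ profileMass_sliceProfile_pos hm h hpos
  obtain ⟨v, hv⟩ := exists_eq_translate_of_volume_eq hA (isCompact_slice h.isCompact β)
    (isCompact_slice h.isCompact (1 / 2 * α + 1 / 2 * β)) cA (convex_slice h.convex β) hA0
    (htop.trans hbottom.symm) (hmiddle.trans hbottom.symm) fun x hx y hy =>
      h.convex hx hy (by norm_num) (by norm_num) (by norm_num)
  refine ⟨Prod.mk α ⁻¹' C, v, hA, cA, hA0, hv ▸ ?_⟩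
  refine eq_slabHull_of_volume_le hm h hpos hA (isCompact_slice h.isCompact β) cA
    (convex_slice h.convex β) h.bottom_nonempty h.top_nonempty subset_rfl subset_rfl
    (sliceProfile_nonneg C α β 0) (sliceProfile_nonneg C α β 1) (sliceProfile_zero_pow hm C α β).le
    (sliceProfile_one_pow hm C α β).le ?_
  rw [volume_real_eq_mul_profileMass hm h, hmass, h01]
  simp only [profileMass, ← add_mul, sub_add_cancel, one_mul, intervalIntegral.integral_const,
    sub_zero, one_smul, le_refl]

theorem profileMass_mul_id (m : ℕ) (b : ℝ) :
    profileMass m (fun s => s * b) = b ^ m / (m + 1) := by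
  simp only [profileMass, mul_pow, intervalIntegral.integral_mul_const, integral_pow]
  simp [div_eq_inv_mul]

theorem isConeBetween_of_bottom_eq_zero (hm : m ≠ 0) (h : IsSlabBody C α β)
    (hpos : 0 < volume.real C)
    (hmass : profileMass m (sliceProfile C α β) = sliceProfile C α β 1 ^ m / (m + 1)) :
    IsConeBetween C β α := by
  have hB := isCompact_slice h.isCompact β
  have cB := convex_slice h.convex β
  have hB0 : 0 < sliceVolume C β := by
    rw [← sliceProfile_one_pow hm C α β]
    exact (div_pos_iff_of_pos_right (by positivity)).1
      (hmass ▸ profileMass_sliceProfile_pos hm h hpos)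
  obtain ⟨z, hz⟩ := h.bottom_nonempty
  refine ⟨Prod.mk β ⁻¹' C, z, hB, cB, hB0, ?_⟩
  rw [slabHull_comm]
  refine eq_slabHull_of_volume_le hm h hpos isCompact_singleton hB (convex_singleton z) cB
    (Set.singleton_nonempty z) h.top_nonempty (Set.singleton_subset_iff.2 hz) subset_rfl le_rfl
    (sliceProfile_nonneg C α β 1) ((zero_pow hm).trans_le measureReal_nonneg)
    (sliceProfile_one_pow hm C α β).le ?_
  simp only [mul_zero, zero_add, profileMass_mul_id]
  rw [volume_real_eq_mul_profileMass hm h, hmass]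

theorem isConeBetween_of_top_eq_zero (hm : m ≠ 0) (h : IsSlabBody C α β)
    (hpos : 0 < volume.real C)
    (hmass : profileMass m (sliceProfile C α β) = sliceProfile C α β 0 ^ m / (m + 1)) :
    IsConeBetween C α β := by
  have hA := isCompact_slice h.isCompact α
  have cA := convex_slice h.convex α
  have hA0 : 0 < sliceVolume C α := by
    rw [← sliceProfile_zero_pow hm C α β]
    exact (div_pos_iff_of_pos_right (by positivity)).1
      (hmass ▸ profileMass_sliceProfile_pos hm h hpos)
  obtain ⟨z, hz⟩ := h.top_nonempty
  refine ⟨Prod.mk α ⁻¹' C, z, hA, cA, hA0, ?_⟩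
  refine eq_slabHull_of_volume_le hm h hpos hA isCompact_singleton cA (convex_singleton z)
    h.bottom_nonempty (Set.singleton_nonempty z) subset_rfl (Set.singleton_subset_iff.2 hz)
    (sliceProfile_nonneg C α β 0) le_rfl (sliceProfile_zero_pow hm C α β).le
    ((zero_pow hm).trans_le measureReal_nonneg) ?_
  simp only [mul_zero, add_zero]
  rw [profileMass_comp_one_sub m (fun s => s * sliceProfile C α β 0), profileMass_mul_id,
    volume_real_eq_mul_profileMass hm h, hmass]

theorem oppositeConeSum_slices_le (hm : 2 ≤ m) (h : IsSlabBody C α β) (hpos : 0 < volume.real C)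
    (hcen : ∫ p in C, p.1 = 0) {x y : ℝ}
    (hx : x = β * sliceVolume C β / ((m + 1) * volume.real C))
    (hy : y = -α * sliceVolume C α / ((m + 1) * volume.real C)) :
    oppositeConeSum (m + 1) x y ≤ 1 ∧ (oppositeConeSum (m + 1) x y = 1 →
      IsPrismBetween C α β ∨ IsConeBetween C β α ∨ IsConeBetween C α β) := by
  have hm0 : m ≠ 0 := by positivity
  have hprofile := oppositeConeSum_profile_le hm (isProfile_sliceProfile hm0 h.isCompact α β)
    (concaveOn_sliceProfile hm0 h) (profileMass_sliceProfile_pos hm0 h hpos)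
  rw [topConeRatio_sliceProfile hm0 h hpos hcen, bottomConeRatio_sliceProfile hm0 h hpos hcen,
    ← hx, ← hy] at hprofile
  refine hprofile.imp_right fun himp heq => ?_
  rcases himp heq with ⟨h01, hmass⟩ | ⟨-, hmass⟩ | ⟨-, hmass⟩
  · exact Or.inl (isPrismBetween_of_profileMass_eq hm0 h hpos h01 hmass)
  · exact Or.inr (Or.inl (isConeBetween_of_bottom_eq_zero hm0 h hpos hmass))
  · exact Or.inr (Or.inr (isConeBetween_of_top_eq_zero hm0 h hpos hmass))

end SliceProfile

theorem exists_isSlabBody {F : Type*} [NormedAddCommGroup F] [NormedSpace ℝ F]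
    {C : Set (ℝ × F)} (hC : IsCompact C) (cC : Convex ℝ C) (nC : C.Nonempty) :
    ∃ α β, IsSlabBody C α β := by
  obtain ⟨p, hp, hmin⟩ := hC.exists_isMinOn nC continuous_fst.continuousOn
  obtain ⟨q, hq, hmax⟩ := hC.exists_isMaxOn nC continuous_fst.continuousOn
  exact ⟨p.1, q.1, hC, cC, fun _ hr => ⟨hmin hr, hmax hr⟩, ⟨p.2, hp⟩, ⟨q.2, hq⟩⟩

theorem IsSlabBody.zero_mem_Icc {m : ℕ} {C : Set (ℝ × (Fin m → ℝ))} {α β : ℝ}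
    (h : IsSlabBody C α β) (hpos : 0 < volume.real C) (hcen : ∫ p in C, p.1 = 0) :
    (0 : ℝ) ∈ Set.Icc α β := by
  have havg : ⨍ p in C, p.1 ∈ Set.Icc α β :=
    (convex_Icc α β).set_average_mem isClosed_Icc (ENNReal.toReal_pos_iff.1 hpos).1.ne'
      h.isCompact.measure_ne_top
      (ae_restrict_of_forall_mem h.isCompact.measurableSet h.fst_mem)
      (continuous_fst.continuousOn.integrableOn_compact h.isCompact)
  rwa [setAverage_eq, hcen, smul_zero] at havg

section HeightCoordinates

variable {E : Type*} [NormedAddCommGroup E] [InnerProductSpace ℝ E] {m : ℕ}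

/-- The coordinates of a vector in an orthonormal basis `b`, with the first one, the height
`⟪b 0, x⟫`, split off. -/
noncomputable def heightCoordinates (b : OrthonormalBasis (Fin (m + 1)) ℝ E) :
    E ≃L[ℝ] ℝ × (Fin m → ℝ) :=
  (b.repr.toContinuousLinearEquiv.trans (EuclideanSpace.equiv (Fin (m + 1)) ℝ)).trans
    (Fin.consEquivL ℝ fun _ : Fin (m + 1) => ℝ).symm

variable (b : OrthonormalBasis (Fin (m + 1)) ℝ E)

theorem fst_heightCoordinates (x : E) : (heightCoordinates b x).1 = ⟪b 0, x⟫ :=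
  b.repr_apply_apply x 0

theorem inner_heightCoordinates_symm (p : ℝ × (Fin m → ℝ)) :
    ⟪b 0, (heightCoordinates b).symm p⟫ = p.1 := by
  rw [← fst_heightCoordinates, ContinuousLinearEquiv.apply_symm_apply]

theorem isometry_heightCoordinates_symm (t : ℝ) :
    Isometry fun w : EuclideanSpace ℝ (Fin m) => (heightCoordinates b).symm (t, WithLp.ofLp w) := by
  refine Isometry.of_dist_eq fun w w' => (b.repr.symm.dist_map _ _).trans ?_
  rw [EuclideanSpace.dist_eq, EuclideanSpace.dist_eq, Fin.sum_univ_succ]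
  simp [Fin.consEquivL]

theorem symm_image_image_heightCoordinates (S : Set E) :
    (heightCoordinates b).symm '' (heightCoordinates b '' S) = S :=
  (heightCoordinates b).toEquiv.symm_image_image S

variable [MeasurableSpace E] [BorelSpace E]

theorem measurePreserving_heightCoordinates [FiniteDimensional ℝ E] :
    MeasurePreserving (heightCoordinates b) :=
  (measurePreserving_consEquivL_symm m).comp
    ((PiLp.volume_preserving_ofLp (Fin (m + 1))).comp b.measurePreserving_repr)

theorem volume_real_image_heightCoordinates [FiniteDimensional ℝ E] (S : Set E) :
    volume.real (heightCoordinates b '' S) = volume.real S :=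
  volume_real_image_of_measurePreserving (measurePreserving_heightCoordinates b) S

theorem setIntegral_fst_image_heightCoordinates [FiniteDimensional ℝ E] {S : Set E}
    (hS : IsCompact S) :
    ∫ p in heightCoordinates b '' S, p.1 = ⟪b 0, ∫ x in S, x⟫ := by
  rw [(measurePreserving_heightCoordinates b).setIntegral_image_emb
    (heightCoordinates b).toHomeomorph.measurableEmbedding]
  simp only [fst_heightCoordinates]
  exact integral_inner (continuous_id.continuousOn.integrableOn_compact hS) (b 0)

theorem euclideanHausdorffMeasure_setOf_inner_eq (S : Set E) (t : ℝ) :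
    μHE[m] {x | x ∈ S ∧ ⟪b 0, x⟫ = t} = volume (Prod.mk t ⁻¹' (heightCoordinates b '' S)) := by
  have himage : {x | x ∈ S ∧ ⟪b 0, x⟫ = t} =
      (fun w : EuclideanSpace ℝ (Fin m) => (heightCoordinates b).symm (t, WithLp.ofLp w)) ''
        (WithLp.ofLp ⁻¹' (Prod.mk t ⁻¹' (heightCoordinates b '' S))) := by
    ext x
    constructor
    · rintro ⟨hx, rfl⟩
      have hheight : (⟪b 0, x⟫, (heightCoordinates b x).2) = heightCoordinates b x := by
        rw [← fst_heightCoordinates]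
      exact ⟨WithLp.toLp 2 (heightCoordinates b x).2, ⟨x, hx, hheight.symm⟩,
        (congrArg _ hheight).trans ((heightCoordinates b).symm_apply_apply x)⟩
    · rintro ⟨w, ⟨y, hy, hyw⟩, rfl⟩
      refine ⟨?_, inner_heightCoordinates_symm b _⟩
      change (heightCoordinates b).symm (t, WithLp.ofLp w) ∈ S
      rwa [← hyw, ContinuousLinearEquiv.symm_apply_apply]
  rw [himage, (isometry_heightCoordinates_symm b t).euclideanHausdorffMeasure_image,
    EuclideanSpace.euclideanHausdorffMeasure_eq_volume]
  exact (PiLp.volume_preserving_ofLp (Fin m)).measure_preimage_equiv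
    (f := (MeasurableEquiv.toLp 2 (Fin m → ℝ)).symm) _

end HeightCoordinates

theorem exists_orthonormalBasis_apply_zero {m : ℕ}
    (u : sphere (0 : EuclideanSpace ℝ (Fin (m + 1))) 1) :
    ∃ b : OrthonormalBasis (Fin (m + 1)) ℝ (EuclideanSpace ℝ (Fin (m + 1))), b 0 = u := by
  have hu : Orthonormal ℝ (({0} : Set (Fin (m + 1))).domRestrict fun _ => u.1) :=
    ⟨fun _ => mem_sphere_zero_iff_norm.1 u.2, fun i j hij => absurd (Subsingleton.elim i j) hij⟩
  obtain ⟨b, hb⟩ := hu.exists_orthonormalBasis_extension_of_card_eq (by simp)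
  exact ⟨b, hb 0 rfl⟩

section ConeVolume

variable {m : ℕ} {K : ConvexBody (EuclideanSpace ℝ (Fin (m + 1)))}
  {v : sphere (0 : EuclideanSpace ℝ (Fin (m + 1))) 1} {t : ℝ}

theorem inner_eq_of_gaussMap_eq (hle : ∀ x ∈ K, ⟪v.1, x⟫ ≤ t) (hmax : ∃ x ∈ K, ⟪v.1, x⟫ = t)
    {x : regularBoundary K} (hx : gaussMap K x = v) : ⟪v.1, x.1⟫ = t := by
  obtain ⟨y, hy, rfl⟩ := hmax
  refine (hle x (regularBoundary_subset K x.2)).antisymm ?_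
  have hnormal := isOuterUnitNormal_gaussMap K x y hy
  rwa [hx, real_inner_comm, real_inner_comm _ x.1] at hnormal

theorem coneVolumeMeasure_singleton_le (hle : ∀ x ∈ K, ⟪v.1, x⟫ ≤ t)
    (hmax : ∃ x ∈ K, ⟪v.1, x⟫ = t) :
    coneVolumeMeasure K {v} ≤
      ((m + 1 : ℕ) : ℝ≥0∞)⁻¹ * (ENNReal.ofReal t * μHE[m] {x | x ∈ K ∧ ⟪v.1, x⟫ = t}) := by
  rw [coneVolumeMeasure_apply K (measurableSet_singleton v)]
  gcongr
  calc ∫⁻ x in gaussMap K ⁻¹' {v}, ENNReal.ofReal ⟪x.1, (gaussMap K x).1⟫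
        ∂((μHE[m] : Measure (EuclideanSpace ℝ (Fin (m + 1)))).comap Subtype.val)
      = ENNReal.ofReal t * μHE[m] (Subtype.val '' (gaussMap K ⁻¹' {v})) := by
        rw [setLIntegral_congr_fun ((continuous_gaussMap K).measurable (measurableSet_singleton v))
          fun x (hx : gaussMap K x = v) => by
            rw [hx, real_inner_comm, inner_eq_of_gaussMap_eq hle hmax hx],
          setLIntegral_const,
          (MeasurableEmbedding.subtype_coe (measurableSet_regularBoundary K)).comap_apply]
    _ ≤ ENNReal.ofReal t * μHE[m] {x | x ∈ K ∧ ⟪v.1, x⟫ = t} := by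
        gcongr
        rintro _ ⟨x, hx, rfl⟩
        exact ⟨regularBoundary_subset K x.2, inner_eq_of_gaussMap_eq hle hmax hx⟩

theorem coneVolumeMeasure_real_singleton_le (ht : 0 ≤ t) (hle : ∀ x ∈ K, ⟪v.1, x⟫ ≤ t)
    (hmax : ∃ x ∈ K, ⟪v.1, x⟫ = t) (hfacet : μHE[m] {x | x ∈ K ∧ ⟪v.1, x⟫ = t} ≠ ∞) :
    (coneVolumeMeasure K).real {v} ≤
      t * (μHE[m]).real {x | x ∈ K ∧ ⟪v.1, x⟫ = t} / (m + 1) := by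
  refine (ENNReal.toReal_mono (ENNReal.mul_ne_top (by simp)
    (ENNReal.mul_ne_top ENNReal.ofReal_ne_top hfacet))
    (coneVolumeMeasure_singleton_le hle hmax)).trans_eq ?_
  rw [ENNReal.toReal_mul, ENNReal.toReal_mul, ENNReal.toReal_inv, ENNReal.toReal_natCast,
    ENNReal.toReal_ofReal ht, Nat.cast_succ, div_eq_inv_mul, Measure.real]

end ConeVolume

theorem finrank_vectorSpan_image_of_injective {k V W : Type*} [DivisionRing k] [AddCommGroup V]
    [Module k V] [AddCommGroup W] [Module k W] {f : V →ᵃ[k] W} (hf : Function.Injective f)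
    (S : Set V) : Module.finrank k (vectorSpan k (f '' S)) = Module.finrank k (vectorSpan k S) := by
  rw [← AffineMap.map_vectorSpan]
  exact (Submodule.equivMapOfInjective f.linear ((AffineMap.linear_injective_iff f).2 hf)
    (vectorSpan k S)).finrank_eq.symm

section ConvexBody

variable {m : ℕ} {K : ConvexBody (EuclideanSpace ℝ (Fin (m + 1)))}
  {u : sphere (0 : EuclideanSpace ℝ (Fin (m + 1))) 1}
  {b : OrthonormalBasis (Fin (m + 1)) ℝ (EuclideanSpace ℝ (Fin (m + 1)))} {α β : ℝ}

theorem coneVolumeMeasure_real_singleton_le_slice (hu : b 0 = u)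
    (h : IsSlabBody (heightCoordinates b '' K) α β) (hβ : 0 ≤ β) :
    (coneVolumeMeasure K).real {u} ≤
      β * sliceVolume (heightCoordinates b '' K) β / (m + 1) := by
  have hfacet := euclideanHausdorffMeasure_setOf_inner_eq b (K : Set _) β
  rw [hu] at hfacet
  rw [sliceVolume, measureReal_def volume, ← hfacet]
  refine coneVolumeMeasure_real_singleton_le hβ (fun x hx => ?_) ?_ ?_
  · rw [← hu, ← fst_heightCoordinates]
    exact (h.fst_mem _ ⟨x, hx, rfl⟩).2
  · obtain ⟨y, x, hx, hxy⟩ := h.top_nonempty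
    exact ⟨x, hx, by rw [← hu, ← fst_heightCoordinates, hxy]⟩
  · exact hfacet ▸ (isCompact_slice h.isCompact β).measure_ne_top

theorem coneVolumeMeasure_real_singleton_neg_le_slice (hu : b 0 = u)
    (h : IsSlabBody (heightCoordinates b '' K) α β) (hα : α ≤ 0) :
    (coneVolumeMeasure K).real {-u} ≤
      -α * sliceVolume (heightCoordinates b '' K) α / (m + 1) := by
  have hheight : ∀ x, ⟪(-u).1, x⟫ = -(heightCoordinates b x).1 := fun x => by
    rw [fst_heightCoordinates, hu, coe_neg_sphere, inner_neg_left]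
  have hfacet := euclideanHausdorffMeasure_setOf_inner_eq b (K : Set _) α
  simp only [← fst_heightCoordinates, ← neg_inj (b := α), ← hheight] at hfacet
  rw [sliceVolume, measureReal_def volume, ← hfacet]
  refine coneVolumeMeasure_real_singleton_le (neg_nonneg.2 hα) (fun x hx => ?_) ?_ ?_
  · rw [hheight]
    exact neg_le_neg (h.fst_mem _ ⟨x, hx, rfl⟩).1
  · obtain ⟨y, x, hx, hxy⟩ := h.bottom_nonempty
    exact ⟨x, hx, by rw [hheight, hxy]⟩
  · exact hfacet ▸ (isCompact_slice h.isCompact α).measure_ne_top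

theorem setIntegral_fst_eq_zero_of_inner_centroid (hu : b 0 = u)
    (hV : 0 < volume.real (K : Set (EuclideanSpace ℝ (Fin (m + 1)))))
    (hcentroid : ⟪u.1, centroid K⟫ = 0) : ∫ p in heightCoordinates b '' K, p.1 = 0 := by
  rw [setIntegral_fst_image_heightCoordinates b K.isCompact, hu]
  rw [centroid, inner_smul_right] at hcentroid
  exact (mul_eq_zero.1 hcentroid).resolve_left (inv_ne_zero hV.ne')

theorem oppositeConeSum_coneVolumeMeasure_le (hm : m ≠ 0) (hu : b 0 = u)
    (h : IsSlabBody (heightCoordinates b '' K) α β) (hzero : (0 : ℝ) ∈ Set.Icc α β) {x y : ℝ}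
    (hx : x = β * sliceVolume (heightCoordinates b '' K) β /
      ((m + 1) * volume.real (heightCoordinates b '' K)))
    (hy : y = -α * sliceVolume (heightCoordinates b '' K) α /
      ((m + 1) * volume.real (heightCoordinates b '' K)))
    (hle : oppositeConeSum (m + 1) x y ≤ 1) :
    oppositeConeSum (m + 1)
        ((coneVolumeMeasure K).real {u} / volume.real (K : Set (EuclideanSpace ℝ (Fin (m + 1)))))
        ((coneVolumeMeasure K).real {-u} / volume.real (K : Set (EuclideanSpace ℝ (Fin (m + 1))))) ≤
      oppositeConeSum (m + 1) x y := by
  rw [← div_div, volume_real_image_heightCoordinates] at hx hy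
  refine (oppositeConeSum_mono (by omega) (by positivity) (by positivity) ?_ ?_ hle).1
  · rw [hx]
    gcongr
    exact coneVolumeMeasure_real_singleton_le_slice hu h hzero.2
  · rw [hy]
    gcongr
    exact coneVolumeMeasure_real_singleton_neg_le_slice hu h hzero.1

theorem exists_isHyperplaneBody (hu : b 0 = u) {S : Set (Fin m → ℝ)} (hS : IsCompact S)
    (cS : Convex ℝ S) (hpos : 0 < volume.real S) (t : ℝ) :
    ∃ P : ConvexBody (EuclideanSpace ℝ (Fin (m + 1))),
      (P : Set (EuclideanSpace ℝ (Fin (m + 1)))) = (heightCoordinates b).symm '' ({t} ×ˢ S) ∧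
        IsHyperplaneBody P u t := by
  have nS : S.Nonempty := nonempty_of_measureReal_ne_zero hpos.ne'
  let P : ConvexBody (EuclideanSpace ℝ (Fin (m + 1))) :=
    { carrier := (heightCoordinates b).symm '' ({t} ×ˢ S)
      convex' := ((convex_singleton t).prod cS).linear_image
        (heightCoordinates b).symm.toLinearMap
      isCompact' := (isCompact_singleton.prod hS).image (heightCoordinates b).symm.continuous
      nonempty' := ((Set.singleton_nonempty t).prod nS).image _ }
  refine ⟨P, rfl, ?_, ?_⟩
  · rintro _ ⟨p, ⟨hp, _⟩, rfl⟩
    exact hu ▸ (inner_heightCoordinates_symm b p).trans hp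
  · let f : (Fin m → ℝ) →ᵃ[ℝ] EuclideanSpace ℝ (Fin (m + 1)) :=
      (heightCoordinates b).symm.toLinearMap.toAffineMap.comp
        ((AffineMap.const ℝ _ t).prod (AffineMap.id ℝ _))
    have hf : Function.Injective f :=
      (heightCoordinates b).symm.injective.comp (Prod.mk_right_injective t)
    have himage : (heightCoordinates b).symm '' ({t} ×ˢ S) = f '' S := by
      rw [Set.singleton_prod, Set.image_image]
      rfl
    have hspan : vectorSpan ℝ S = ⊤ := AffineSubspace.vectorSpan_eq_top_of_affineSpan_eq_top ℝ _ _
      (cS.interior_nonempty_iff_affineSpan_eq_top.1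
        (nonempty_interior_of_convex_of_measureReal_pos volume cS hpos))
    change Module.finrank ℝ (vectorSpan ℝ ((heightCoordinates b).symm '' ({t} ×ˢ S))) = m
    rw [himage, finrank_vectorSpan_image_of_injective hf, hspan, finrank_top,
      Module.finrank_fin_fun]

theorem eq_convexHull_of_image_eq_slabHull {A B : Set (Fin m → ℝ)}
    (h : heightCoordinates b '' K = slabHull α β A B) :
    (K : Set (EuclideanSpace ℝ (Fin (m + 1)))) =
      convexHull ℝ ((heightCoordinates b).symm '' ({α} ×ˢ A) ∪
        (heightCoordinates b).symm '' ({β} ×ˢ B)) := by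
  rw [← symm_image_image_heightCoordinates b (K : Set _), h, ← Set.image_union]
  exact (heightCoordinates b).symm.toLinearMap.image_convexHull _

theorem isObliquePrism_of_isPrismBetween (hu : b 0 = u) (hαβ : α ≠ β)
    (h : IsPrismBetween (heightCoordinates b '' K) α β) : IsObliquePrism K u := by
  obtain ⟨A, v, hA, cA, hpos, hK⟩ := h
  obtain ⟨P, hP, hPbody⟩ := exists_isHyperplaneBody hu hA cA hpos α
  refine ⟨P, α, (heightCoordinates b).symm (β - α, v), hPbody, ?_, ?_⟩
  · rw [← hu, inner_heightCoordinates_symm]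
    exact sub_ne_zero.2 hαβ.symm
  · rw [eq_convexHull_of_image_eq_slabHull hK, hP]
    simp only [Set.singleton_prod, Set.image_image, ← map_add, Prod.mk_add_mk, add_sub_cancel]

theorem isCone_of_isConeBetween (hu : b 0 = u) (hαβ : α ≠ β)
    (h : IsConeBetween (heightCoordinates b '' K) α β) : IsCone K u := by
  obtain ⟨A, z, hA, cA, hpos, hK⟩ := h
  obtain ⟨P, hP, hPbody⟩ := exists_isHyperplaneBody hu hA cA hpos α
  refine ⟨P, α, (heightCoordinates b).symm (β, z), hPbody, ?_, ?_⟩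
  · rw [← hu, inner_heightCoordinates_symm]
    exact hαβ.symm
  · rw [eq_convexHull_of_image_eq_slabHull hK, hP, Set.singleton_prod_singleton,
      Set.image_singleton]

end ConvexBody

end LogMinkowski

open LogMinkowski in
theorem theorem1p1_general (n : ℕ) (hn : 3 ≤ n) (K : ConvexBody (EuclideanSpace ℝ (Fin n)))
    (hK : (interior (K : Set (EuclideanSpace ℝ (Fin n)))).Nonempty)
    (μ : Measure (sphere (0 : EuclideanSpace ℝ (Fin n)) 1))
    (hμ : μ = coneVolumeMeasure K)
    (V : ℝ) (hV : V = volume.real (K : Set (EuclideanSpace ℝ (Fin n))))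
    (u : sphere (0 : EuclideanSpace ℝ (Fin n)) 1)
    (hcentroid : ⟪(u : EuclideanSpace ℝ (Fin n)), centroid K⟫ = 0) :
    (n : ℝ) * ((μ.real {u} + μ.real {-u}) / V)
        + ((n : ℝ) + 1) ^ (n - 1) * |(μ.real {u} - μ.real {-u}) / V| ^ n ≤ 1 ∧
      ((n : ℝ) * ((μ.real {u} + μ.real {-u}) / V)
          + ((n : ℝ) + 1) ^ (n - 1) * |(μ.real {u} - μ.real {-u}) / V| ^ n = 1 →
        IsObliquePrism K u ∨ IsCone K u) := by
  obtain ⟨m, rfl⟩ : ∃ m, n = m + 1 := ⟨n - 1, by omega⟩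
  subst hμ hV
  obtain ⟨b, hu⟩ := exists_orthonormalBasis_apply_zero u
  have hV : 0 < volume.real (K : Set (EuclideanSpace ℝ (Fin (m + 1)))) := ENNReal.toReal_pos
    (Measure.measure_pos_of_nonempty_interior volume hK).ne' K.isCompact.measure_ne_top
  have hpos := (volume_real_image_heightCoordinates b (K : Set _)).symm ▸ hV
  have hcen := setIntegral_fst_eq_zero_of_inner_centroid hu hV hcentroid
  obtain ⟨α, β, h⟩ := exists_isSlabBody (K.isCompact.image (heightCoordinates b).continuous)
    (K.convex.linear_image (heightCoordinates b).toLinearMap) (K.nonempty.image _)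
  obtain ⟨hle, heq⟩ := oppositeConeSum_slices_le (by omega) h hpos hcen rfl rfl
  have hfacets := oppositeConeSum_coneVolumeMeasure_le (by omega) hu h (h.zero_mem_Icc hpos hcen)
    rfl rfl hle
  have hαβ := lt_of_volume_real_pos (by omega) h hpos
  rw [add_div, sub_div]
  refine ⟨hfacets.trans hle, fun hone => ?_⟩
  rcases heq (hle.antisymm (hone.ge.trans hfacets)) with hprism | hcone | hcone
  · exact Or.inl (isObliquePrism_of_isPrismBetween hu hαβ.ne hprism)
  · exact Or.inr (isCone_of_isConeBetween hu hαβ.ne' hcone)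
  · exact Or.inr (isCone_of_isConeBetween hu hαβ.ne hcone)

theorem theorem1p1 (n : ℕ) (hn : 3 ≤ n) (K : ConvexBody (EuclideanSpace ℝ (Fin n)))
    (hK : (interior (K : Set (EuclideanSpace ℝ (Fin n)))).Nonempty)
    (hcentroid : LogMinkowski.centroid K = 0)
    (μ : Measure (sphere (0 : EuclideanSpace ℝ (Fin n)) 1))
    (hμ : μ = LogMinkowski.coneVolumeMeasure K)
    (V : ℝ) (hV : V = volume.real (K : Set (EuclideanSpace ℝ (Fin n))))
    (u : sphere (0 : EuclideanSpace ℝ (Fin n)) 1) :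
    (n : ℝ) * ((μ.real {u} + μ.real {-u}) / V)
        + ((n : ℝ) + 1) ^ (n - 1) * |(μ.real {u} - μ.real {-u}) / V| ^ n ≤ 1 ∧
      ((n : ℝ) * ((μ.real {u} + μ.real {-u}) / V)
          + ((n : ℝ) + 1) ^ (n - 1) * |(μ.real {u} - μ.real {-u}) / V| ^ n = 1 →
        LogMinkowski.IsObliquePrism K u ∨ LogMinkowski.IsCone K u) :=
  theorem1p1_general n hn K hK μ hμ V hV u (by rw [hcentroid, inner_zero_right])
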